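/- Let $n\ge 1$ and let $w=w_1w_2\cdots w_n\in S_n$. Let $T(w)$ be the standard skew tableau (English notation) with $n$ rows of one cell each, of shape $(n,n-1,\dots,1)/(n-1,n-2,\dots,1,0)$, whose entries read from the bottom row to the top row are $w_1,\dots,w_n$. For $k\ge 1$ let $T(w)^{(k)}$ be the standard skew tableau obtained by attaching to the right of $T(w)$, row by row, $k-1$ copies of $T(w)$ with entries increased by $n,2n,\dots,(k-1)n$; thus its row containing $w_i$ reads $w_i,\,w_i+n,\dots,w_i+(k-1)n$. Let $\mathrm{Rect}$ denote jeu de taquin rectification. Say that $w$ stabilizes at $k$ if each of the entries $(k-1)n+1,\dots,kn$ lies in the same row of $\mathrm{Rect}(T(w)^{(k)})$ as of $T(w)^{(k)}$, and let $\mathrm{stab}(w)$ be the smallest $k\ge 1$ at which $w$ stabilizes. Let $Q(w)$ be the recording tableau of $w$ under RSK row insertion. For $1\le k\le n-1$ let $T_k$ be the following standard tableau of size $n$ with two columns (listed from top to bottom): if $2k\le n$, the first column is $1,\dots,k,2k+1,\dots,n$ and the second column is $k+1,\dots,2k$; if $2k>n$, the first column is $1,\dots,k$ and the second column is $k+1,\dots,n$.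 **Theorem.** For all integers $n\ge 1$, $$\{w\in S_n:\mathrm{stab}(w)=2\}=\{w\in S_n: Q(w)=T_k\text{ for some }1\le k\le n-1\}.$$ Consequently, $$\#\{w\in S_n:\mathrm{stab}(w)=2\}=\binom{n+1}{\lfloor (n+1)/2\rfloor}-2.$$ -/

import Mathlib

namespace TableauStab

/-! ### Skew tableaux and jeu de taquin

Rows and columns are numbered from `0`, rows from top to bottom (English convention). -/

/-- A filling of finitely many cells of the quadrant; `none` marks an empty cell. -/
abbrev Filling := ℕ → ℕ → Option ℕ

/-- A filled skew shape `λ/μ`, given by its rows from top to bottom. The row `(μᵢ, l)` consists of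
`μᵢ` cells of the inner shape followed by cells whose entries, from left to right, are `l`. -/
abbrev SkewRows := List (ℕ × List ℕ)

namespace SkewRows

/-- The number of (filled) cells. -/
def size (S : SkewRows) : ℕ := (S.map fun r => r.2.length).sum

/-- The entry in row `i` and column `j`, if there is one. -/
def toFilling (S : SkewRows) : Filling := fun i j =>
  match S[i]? with
  | none => none
  | some r => if r.1 ≤ j then r.2[j - r.1]? else none

/-- `S^(k)`: attach `k - 1` copies of `S`, with entries shifted by `m, 2m, …, (k-1)m` where `m` is
the size of `S`, to the right of `S`, row by row. -/
def copies (S : SkewRows) (k : ℕ) : SkewRows :=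
  S.map fun r => (r.1, (List.range k).flatMap fun t => r.2.map fun x => x + t * S.size)

/-- The cells of the inner shape, rows from bottom to top and each row from right to left.
Removing the cells of the inner shape in this order, each of them is an outer corner of what is
left of the inner shape when its turn comes. -/
def innerCells (S : SkewRows) : List (ℕ × ℕ) :=
  (List.range S.length).reverse.flatMap fun i =>
    (List.range ((S.map Prod.fst).getD i 0)).reverse.map fun j => (i, j)

end SkewRows

/-- Overwrite the content of the cell in row `i` and column `j`. -/
def Filling.set (F : Filling) (i j : ℕ) (v : Option ℕ) : Filling := fun i' j' =>
  if i' = i ∧ j' = j then v else F i' j'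

/-- The jeu de taquin slide into the empty cell `(i, j)`: as long as the cell to the right of the
hole or the cell below it is filled, the smaller of these (at most two) entries moves into the hole
and leaves the hole at its old place. The first argument bounds the number of moves. -/
def slide : ℕ → ℕ → ℕ → Filling → Filling
  | 0, _, _, F => F
  | fuel + 1, i, j, F =>
    match F i (j + 1), F (i + 1) j with
    | none, none => F
    | some a, none => slide fuel i (j + 1) ((F.set i j (some a)).set i (j + 1) none)
    | none, some b => slide fuel (i + 1) j ((F.set i j (some b)).set (i + 1) j none)
    | some a, some b =>
      if a < b then slide fuel i (j + 1) ((F.set i j (some a)).set i (j + 1) none)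
      else slide fuel (i + 1) j ((F.set i j (some b)).set (i + 1) j none)

/-- The rectification of `S`: perform inner slides into the cells of the inner shape until none is
left. Every entry moves at most once in a slide, so `S.size` bounds the number of moves. (The result
does not depend on the order in which the outer corners of the inner shape are chosen.) -/
def rect (S : SkewRows) : Filling :=
  S.innerCells.foldl (fun F c => slide S.size c.1 c.2 F) S.toFilling

/-- The number `x` is an entry of row `i`. -/
def Filling.InRow (F : Filling) (x i : ℕ) : Prop := ∃ j, F i j = some x

/-- `S` stabilizes at `k ≥ 1`: with `m` the size of `S`, each of the entries
`(k - 1)m + 1, …, km` lies in the same row of the rectification of `S^(k)` as of `S^(k)`. -/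
def StabilizesAt (S : SkewRows) (k : ℕ) : Prop :=
  1 ≤ k ∧ ∀ x ∈ Finset.Icc ((k - 1) * S.size + 1) (k * S.size), ∀ i,
    (rect (S.copies k)).InRow x i ↔ (S.copies k).toFilling.InRow x i

/-- The least `k ≥ 1` at which `S` stabilizes (and `0` if there were none). -/
noncomputable def stab (S : SkewRows) : ℕ := sInf {k | StabilizesAt S k}

/-! ### Permutations -/

/-- The one-line notation `w₁ w₂ … wₙ`, a word in the letters `1, …, n`. -/
def word {n : ℕ} (w : Equiv.Perm (Fin n)) : List ℕ := List.ofFn fun i => (w i : ℕ) + 1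

/-- `T(w)`: the standard skew tableau of antidiagonal shape `(1) ∪ ⋯ ∪ (1)` with reading word `w`
(rows from bottom to top), so that `w₁` is at the left end of the bottom row. Its row number `i` has
`n - 1 - i` inner cells followed by the single entry `w_{n - i}`. -/
def permTableau {n : ℕ} (w : Equiv.Perm (Fin n)) : SkewRows :=
  List.ofFn fun i : Fin n => (n - 1 - (i : ℕ), [(w i.rev : ℕ) + 1])

/-- The stabilization statistic of a permutation. -/
noncomputable def permStab {n : ℕ} (w : Equiv.Perm (Fin n)) : ℕ := stab (permTableau w)

/-! ### Row insertion and the recording tableau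

A tableau of straight shape is given by the list of its rows, from top to bottom. -/

/-- Insert `x` into a row: it replaces the leftmost entry larger than `x`, which is bumped and
returned; if there is no such entry, `x` is put at the end of the row. -/
def insertIntoRow (x : ℕ) : List ℕ → List ℕ × Option ℕ
  | [] => ([x], none)
  | y :: ys =>
    if x < y then (x :: ys, some y)
    else (y :: (insertIntoRow x ys).1, (insertIntoRow x ys).2)

/-- Row insertion of `x` into a tableau. It returns the new tableau and the number of the row that
the new cell is in. -/
def rowInsert : ℕ → List (List ℕ) → List (List ℕ) × ℕ
  | x, [] => ([[x]], 0)
  | x, r :: rs =>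
    match insertIntoRow x r with
    | (r', none) => (r' :: rs, 0)
    | (r', some y) => (r' :: (rowInsert y rs).1, (rowInsert y rs).2 + 1)

/-- Add a cell with entry `t` at the end of row `i` (as a new last row if there is no row `i`). -/
def addCell (t : ℕ) : ℕ → List (List ℕ) → List (List ℕ)
  | _, [] => [[t]]
  | 0, r :: rs => (r ++ [t]) :: rs
  | i + 1, r :: rs => r :: addCell t i rs

/-- The pair `(P(u), Q(u))` of the insertion and the recording tableau of a word `u = u₁ … uₙ`:
the letters are inserted one after the other, and the cell created by the insertion of `u_t` gets
the entry `t` in the recording tableau. -/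
def rsk (u : List ℕ) : List (List ℕ) × List (List ℕ) :=
  (u.zipIdx 1).foldl
    (fun PQ xt => ((rowInsert xt.1 PQ.1).1, addCell xt.2 (rowInsert xt.1 PQ.1).2 PQ.2)) ([], [])

/-- The recording tableau `Q(w)`. -/
def recordingTableau {n : ℕ} (w : Equiv.Perm (Fin n)) : List (List ℕ) := (rsk (word w)).2

/-- The tableau `T_k` of size `n`, for `1 ≤ k ≤ n`.
If `2k ≤ n`, its columns are `1, …, k, 2k + 1, …, n` and `k + 1, …, 2k`.
If `2k > n`, its columns are `1, …, k` and `k + 1, …, n`. -/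
def twoColumnTableau (n k : ℕ) : List (List ℕ) :=
  if 2 * k ≤ n then
    (List.range k).map (fun i => [i + 1, k + 1 + i]) ++
      (List.range (n - 2 * k)).map (fun i => [2 * k + 1 + i])
  else
    (List.range (n - k)).map (fun i => [i + 1, k + 1 + i]) ++
      (List.range (2 * k - n)).map (fun i => [n - k + 1 + i])

end TableauStab

namespace TableauStab

/-! ### Single moves of a slide -/

/-! Read `w` letter by letter. This builds the rectification of `T(w)^(2)` row by row from the
bottom, and it is compared with the row insertion of `w`. As long as none of the large entries `n+1,
…, 2n` has left its row, the small entries of the rectified part form a two-column tableau, equal to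
the insertion tableau of the prefix, and each row ends with one large entry (`IsState`).

Let the columns have lengths `l₂ ≤ l₁`, so that `l₁ + l₂ = m`, and let the next letter be smaller
than the top of the second column and than the letter before it (no condition if `l₂ = 0`). Then the
last slide rearranges the small entries exactly as insertion does. Its hole reaches the end of the
column that insertion does not extend. There, either the large entry to the right moves left, or the
one below moves up; which of them moves depends on whether two consecutive letters of `w` form a
descent or an ascent. Entries never move down, so a large entry that has moved up never returns
(`Above.slide`).

Three properties of a prefix are followed together: no large entry has moved up; the new cells of
the insertions lie in the rows prescribed by `T_k`; the word satisfies the explicit inequalities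
`IsTwoRun`. By `IsTwoRunState.step` a new letter preserves all three (possibly with a new `k`) or
destroys all three, and they never recover. Hence stabilization at `2`, `IsTwoRun` for some `k ≤ n`,
and `Q(w) = T_k` for some `k ≤ n` are equivalent. The value `k = n` belongs to the decreasing word,
the only one that stabilizes at `1`.

For the count with `2k ≤ n`, a two-run word is determined by the set of values of its first run, and
the sets that occur are ballot sets, `C(n,k) - C(n,k-1)` in number. Reverse complementation
exchanges `k` and `n - k`, so the sum over `k` splits into two telescoping sums, which Pascal's rule
combines. -/

theorem slide_right {f i j a : ℕ} {F : Filling} (h : F i (j + 1) = some a)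
    (hb : ∀ b, F (i + 1) j = some b → a < b) :
    slide (f + 1) i j F = slide f i (j + 1) ((F.set i j (some a)).set i (j + 1) none) := by
  rw [slide, h]
  rcases h' : F (i + 1) j with _ | b
  · rfl
  · simp [hb b h']

theorem slide_down {f i j b : ℕ} {F : Filling} (h : F (i + 1) j = some b)
    (ha : ∀ a, F i (j + 1) = some a → b < a) :
    slide (f + 1) i j F = slide f (i + 1) j ((F.set i j (some b)).set (i + 1) j none) := by
  rw [slide, h]
  rcases h' : F i (j + 1) with _ | a
  · rfl
  · simp [(ha a h').le]

theorem slide_stop {f i j : ℕ} {F : Filling} (h : F (i + 1) j = none) (h' : F i (j + 1) = none) :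
    slide f i j F = F := by
  cases f
  · rfl
  · rw [slide, h, h']

/-- The filling after the hole has moved down from `(i, j)` to `(i + d, j)`. -/
def colShift (F : Filling) (i j d : ℕ) : Filling := fun i' j' =>
  if j' = j ∧ i ≤ i' ∧ i' < i + d then F (i' + 1) j
  else if j' = j ∧ i' = i + d then none else F i' j'

/-- Moving down column `j` changes no cell right of the hole or below it, so every comparison can be
made in the original filling. -/
theorem slide_down_path {f i j d : ℕ} {F : Filling} (h0 : F i j = none)
    (h : ∀ t < d, ∃ b, F (i + t + 1) j = some b ∧ ∀ a, F (i + t) (j + 1) = some a → b < a) :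
    slide (f + d) i j F = slide f (i + d) j (colShift F i j d) := by
  induction d generalizing f with
  | zero =>
    congr 1
    funext i' j'
    simp only [colShift]
    split_ifs with h1 h2
    · omega
    · rw [h2.1, h2.2]; exact h0
    · rfl
  | succ d ih =>
    obtain ⟨b, hb, hb'⟩ := h d (by omega)
    rw [show f + (d + 1) = (f + 1) + d by omega, ih fun t ht => h t (by omega)]
    rw [slide_down (b := b)]
    · rw [show i + (d + 1) = i + d + 1 by omega]
      congr 1
      funext i' j'
      simp only [colShift, Filling.set]
      grind
    · simp only [colShift]; grind
    · intro a ha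
      apply hb' a
      simp only [colShift] at ha
      grind

/-! ### Entries never move down -/

/-- All occurrences of `x` in `F` are above row `g`. -/
def Above (x g : ℕ) (F : Filling) : Prop := ∀ i j, F i j = some x → i < g

/-- A move takes an entry one step left or one step up, so row indices never grow. -/
theorem Above.slide {x g : ℕ} (f : ℕ) (i j : ℕ) {F : Filling} (h : Above x g F) :
    Above x g (slide f i j F) := by
  induction f generalizing i j F with
  | zero => exact h
  | succ f ih =>
    have key1 : ∀ a, F i (j + 1) = some a →
        Above x g ((F.set i j (some a)).set i (j + 1) none) := by
      intro a ha i' j' h'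
      simp only [Filling.set] at h'
      split_ifs at h' with h1 h2
      · rw [h2.1]; exact h _ _ (ha.trans h')
      · exact h _ _ h'
    have key2 : ∀ a, F (i + 1) j = some a →
        Above x g ((F.set i j (some a)).set (i + 1) j none) := by
      intro a ha i' j' h'
      simp only [Filling.set] at h'
      split_ifs at h' with h1 h2
      · rw [h2.1]; exact (Nat.lt_succ_self i).trans (h _ _ (ha.trans h'))
      · exact h _ _ h'
    rw [TableauStab.slide]
    rcases h1 : F i (j + 1) with _ | a <;> rcases h2 : F (i + 1) j with _ | b <;> simp only
    · exact h
    · exact ih _ _ (key2 b h2)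
    · exact ih _ _ (key1 a h1)
    · split_ifs
      · exact ih _ _ (key1 a h1)
      · exact ih _ _ (key2 b h2)

/-- If the hole moves down to row `i + d` and then `b` moves up, then `b` stays above its row. -/
theorem above_of_path {f i j d a b : ℕ} {F : Filling} (h0 : F i j = none)
    (h : ∀ t < d, ∃ b, F (i + t + 1) j = some b ∧ ∀ a, F (i + t) (j + 1) = some a → b < a)
    (ha : F (i + d) (j + 1) = some a) (hb : F (i + d + 1) j = some b) (hba : b < a)
    -- No copy of `b` lies lower than the cell below the final hole, or elsewhere in that cell's
    -- row; once this one moves up, every copy is above the row.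
    (hu : ∀ i' j', F i' j' = some b → i' ≤ i + d + 1 ∧ (i' = i + d + 1 → j' = j)) :
    Above b (i + d + 1) (TableauStab.slide (f + 1 + d) i j F) := by
  rw [slide_down_path h0 h, slide_down (b := b)]
  · apply Above.slide
    intro i' j'
    simp only [colShift, Filling.set]
    grind
  · simp only [colShift]; grind
  · simp only [colShift]; grind

/-! ### Adding a row on top -/

/-- The filling with first row `r` and remaining rows `G`. -/
def consRow (r : ℕ → Option ℕ) (G : Filling) : Filling
  | 0 => r
  | i + 1 => G i

/-- A row with `p` empty cells followed by `l`. -/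
def skewRow (p : ℕ) (l : List ℕ) : ℕ → Option ℕ := fun j => if p ≤ j then l[j - p]? else none

theorem consRow_set (r : ℕ → Option ℕ) (G : Filling) (i j : ℕ) (a : Option ℕ) :
    (consRow r G).set (i + 1) j a = consRow r (G.set i j a) := by
  funext i' j'
  cases i' <;> simp [consRow, Filling.set]

/-- A slide inspects only cells to the right of the hole and below it, so a slide that starts below
the top row never sees that row. -/
theorem slide_consRow (r : ℕ → Option ℕ) (G : Filling) (f i j : ℕ) :
    slide f (i + 1) j (consRow r G) = consRow r (slide f i j G) := by
  induction f generalizing i j G with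
  | zero => rfl
  | succ f ih =>
    simp only [slide, consRow_set, ih]
    simp only [consRow]
    rcases G i (j + 1) with _ | a <;> rcases G (i + 1) j with _ | b <;> simp only
    split_ifs <;> rfl

theorem foldl_slide_consRow (r : ℕ → Option ℕ) (G : Filling) (f : ℕ) (l : List (ℕ × ℕ)) :
    (l.map fun c => (c.1 + 1, c.2)).foldl (fun F c => slide f c.1 c.2 F) (consRow r G) =
      consRow r (l.foldl (fun F c => slide f c.1 c.2 F) G) := by
  induction l generalizing G with
  | nil => rfl
  | cons c l ih => simp [slide_consRow, ih]

/-- Rectification with an explicit bound `f` on the number of moves in each slide. -/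
def rectFuel (f : ℕ) (S : SkewRows) : Filling :=
  S.innerCells.foldl (fun F c => slide f c.1 c.2 F) S.toFilling

theorem innerCells_cons (r : ℕ × List ℕ) (S : SkewRows) :
    SkewRows.innerCells (r :: S) = (S.innerCells.map fun c => (c.1 + 1, c.2)) ++
      (List.range r.1).reverse.map fun j => (0, j) := by
  unfold SkewRows.innerCells
  rw [List.length_cons, List.range_succ_eq_map, List.reverse_cons, List.flatMap_append,
    List.map_flatMap, ← List.map_reverse, List.flatMap_map]
  simp [Function.comp_def]

theorem toFilling_cons (r : ℕ × List ℕ) (S : SkewRows) :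
    SkewRows.toFilling (r :: S) = consRow (skewRow r.1 r.2) S.toFilling := by
  funext i j
  cases i <;> simp [SkewRows.toFilling, consRow, skewRow]

/-- The recursion behind the whole proof: the lower rows are completely rectified before the first
slide in the top row. The bound `f` must be the same on both sides, hence is kept independent of the
size. -/
theorem rectFuel_cons (f : ℕ) (r : ℕ × List ℕ) (S : SkewRows) :
    rectFuel f (r :: S) = (List.range r.1).reverse.foldl (fun F j => slide f 0 j F)
      (consRow (skewRow r.1 r.2) (rectFuel f S)) := by
  rw [rectFuel, innerCells_cons, List.foldl_append, toFilling_cons, foldl_slide_consRow,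
    List.foldl_map]
  rfl

theorem Above.foldl_slide {x g : ℕ} (f : ℕ) (l : List ℕ) {F : Filling} (h : Above x g F) :
    Above x g (l.foldl (fun F j => TableauStab.slide f 0 j F) F) := by
  induction l generalizing F with
  | nil => exact h
  | cons j l ih => exact ih (h.slide f 0 j)

/-! ### Two-column fillings followed by one large entry in each row -/

/-- The two-column tableau with columns `c` (of length `l₁`) and `d` (of length `l₂`), where for
`i < m` the entry `B i` is attached at the end of row `i`. -/
def tab (l₁ l₂ m : ℕ) (c d B : ℕ → ℕ) : Filling := fun i j =>
  if i < l₂ then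
    if j = 0 then some (c i) else if j = 1 then some (d i) else if j = 2 then some (B i) else none
  else if i < l₁ then
    if j = 0 then some (c i) else if j = 1 then some (B i) else none
  else if i < m then
    if j = 0 then some (B i) else none
  else none

/-- The filling whose first row is empty, `D 0`, `B 0`, above a two-column tableau with columns
`c` and `D 1, D 2, …`. -/
def topTab (l₁ l₂ m : ℕ) (c D B : ℕ → ℕ) : Filling := fun i j =>
  if i = 0 then
    if j = 1 then some (D 0) else if j = 2 then some (B 0) else none
  else if i ≤ l₂ then
    if j = 0 then some (c (i - 1)) else if j = 1 then some (D i)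
    else if j = 2 then some (B i) else none
  else if i ≤ l₁ then
    if j = 0 then some (c (i - 1)) else if j = 1 then some (B i) else none
  else if i ≤ m then
    if j = 0 then some (B i) else none
  else none

theorem consRow_tab (l₁ l₂ m : ℕ) (c D B : ℕ → ℕ) :
    consRow (skewRow 1 [D 0, B 0]) (tab l₁ l₂ m c (fun i => D (i + 1)) fun i => B (i + 1)) =
      topTab l₁ l₂ m c D B := by
  funext i j
  cases i with
  | zero =>
    rcases j with _ | _ | _ | j <;> simp [consRow, skewRow, topTab]
  | succ i =>
    simp only [consRow, tab, topTab]
    grind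

section FinalSlide

variable {f l₁ l₂ m p N : ℕ} {c D B : ℕ → ℕ}

/-- The hole runs down the whole first column. At its end `hdes` makes `B l₁` move left instead of
`B (l₁ + 1)` moving up. -/
theorem slide_topTab_of_forall_lt (h21 : l₂ < l₁) (h1m : l₁ ≤ m) (hc : ∀ i < l₁, c i ≤ N)
    (hB : ∀ i ≤ m, N < B i) (hcD : ∀ i ≤ l₂, c i < D i)
    (hf : l₁ + 1 ≤ f) (hdes : l₁ < m → B l₁ < B (l₁ + 1)) :
    slide f 0 0 (topTab l₁ l₂ m c D B) = tab l₁ (l₂ + 1) (m + 1) c D B := by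
  obtain ⟨g, rfl⟩ : ∃ g, f = g + 1 + l₁ := ⟨f - l₁ - 1, by omega⟩
  rw [slide_down_path, slide_right (a := B l₁)]
  · rw [slide_stop]
    · funext i j
      simp only [Filling.set, colShift, topTab, tab]
      grind
    · simp only [Filling.set, colShift, topTab]; grind
    · simp only [Filling.set, colShift, topTab]; grind
  · simp only [colShift, topTab]; grind
  · simp only [colShift, topTab]; grind
  · simp [topTab]
  · intro t ht
    refine ⟨c t, ?_, ?_⟩
    · simp only [topTab]; grind
    · have := hc t ht
      have := hB t (by omega)
      simp only [topTab]; grind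

/-- The state after the hole has moved to `(p, 1)`. -/
theorem slide_topTab_turn (hp2 : p ≤ l₂) (h21 : l₂ ≤ l₁)
    (hD : ∀ i ≤ l₂, D i ≤ N) (hB : ∀ i ≤ m, N < B i) (hcD : ∀ i < p, c i < D i)
    (hp : p < l₁ → D p < c p) :
    slide (f + 1 + p) 0 0 (topTab l₁ l₂ m c D B) = slide f p 1
      (((colShift (topTab l₁ l₂ m c D B) 0 0 p).set p 0 (some (D p))).set p 1 none) := by
  rw [slide_down_path, slide_right (a := D p)]
  · simp
  · simp only [colShift, topTab]; grind
  · have := hD p hp2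
    have := hB (p + 1)
    simp only [colShift, topTab]; grind
  · simp [topTab]
  · intro t ht
    refine ⟨c t, ?_, ?_⟩
    · simp only [topTab]; grind
    · simp only [topTab]; grind

/-- The hole runs down the first column to row `p`, turns right, and runs down to the end of the
second column, where `hdes` makes `B l₂` move left. The new columns are those of
`rowInsert_colRows_of_lt`. -/
theorem slide_topTab_of_lt (h1m : l₁ ≤ m) (hp2 : p ≤ l₂) (hp1 : p ≤ l₁) (h21 : l₂ ≤ l₁)
    (hD : ∀ i ≤ l₂, D i ≤ N) (hB : ∀ i ≤ m, N < B i) (hcD : ∀ i < p, c i < D i)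
    (hp : p < l₁ → D p < c p) (hf : l₂ + 2 ≤ f) (hdes : l₂ < l₁ → B l₂ < B (l₂ + 1)) :
    slide f 0 0 (topTab l₁ l₂ m c D B) = tab (l₁ + 1) l₂ (m + 1)
      (fun i => if i < p then c i else if i = p then D p else c (i - 1))
      (fun i => if i < p then D i else D (i + 1)) B := by
  obtain ⟨g, rfl⟩ : ∃ g, f = g + 1 + (l₂ - p) + 1 + p := ⟨f - l₂ - 2, by omega⟩
  rw [slide_topTab_turn hp2 h21 hD hB hcD hp, slide_down_path, slide_right (a := B l₂)]
  · rw [slide_stop]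
    · funext i j
      simp only [Filling.set, colShift, topTab, tab]
      rcases j with _ | _ | _ | j <;> grind
    · simp only [Filling.set, colShift, topTab]; grind
    · simp only [Filling.set, colShift, topTab]; grind
  · simp only [Filling.set, colShift, topTab]; grind
  · simp only [Filling.set, colShift, topTab]; grind
  · simp [Filling.set]
  · intro t ht
    refine ⟨D (p + t + 1), ?_, ?_⟩
    · simp only [Filling.set, colShift, topTab]; grind
    · have := hD (p + t + 1) (by omega)
      have := hB (p + t) (by omega)
      simp only [Filling.set, colShift, topTab]; grind

/-- The same path as in `slide_topTab_of_lt`, with the opposite outcome of the last comparison. -/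
theorem above_slide_topTab_of_lt (h1m : l₁ ≤ m) (hp2 : p ≤ l₂) (h21 : l₂ < l₁)
    (hc : ∀ i < l₁, c i ≤ N) (hinj : ∀ i ≤ m, ∀ j ≤ m, B i = B j → i = j)
    (hD : ∀ i ≤ l₂, D i ≤ N) (hB : ∀ i ≤ m, N < B i) (hcD : ∀ i < p, c i < D i)
    (hp : p < l₁ → D p < c p) (hf : l₂ + 2 ≤ f) (hdes : B (l₂ + 1) < B l₂) :
    Above (B (l₂ + 1)) (l₂ + 1) (slide f 0 0 (topTab l₁ l₂ m c D B)) := by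
  obtain ⟨g, rfl⟩ : ∃ g, f = g + 1 + (l₂ - p) + 1 + p := ⟨f - l₂ - 2, by omega⟩
  rw [slide_topTab_turn hp2 h21.le hD hB hcD hp]
  have := above_of_path (i := p) (j := 1) (f := g) (d := l₂ - p) (a := B l₂) (b := B (l₂ + 1))
    (F := ((colShift (topTab l₁ l₂ m c D B) 0 0 p).set p 0 (some (D p))).set p 1 none)
    ?_ ?_ ?_ ?_ hdes ?_
  · rwa [show p + (l₂ - p) + 1 = l₂ + 1 by omega] at this
  · simp [Filling.set]
  · intro t ht
    refine ⟨D (p + t + 1), ?_, ?_⟩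
    · simp only [Filling.set, colShift, topTab]; grind
    · have := hD (p + t + 1) (by omega)
      have := hB (p + t) (by omega)
      simp only [Filling.set, colShift, topTab]; grind
  · simp only [Filling.set, colShift, topTab]; grind
  · simp only [Filling.set, colShift, topTab]; grind
  · intro i j
    have := hB (l₂ + 1) (by omega)
    simp only [Filling.set, colShift, topTab]
    rcases j with _ | _ | _ | j <;> grind

end FinalSlide

/-! ### Slides in the first row -/

section FirstRow

variable {f x X : ℕ} {G : Filling}

theorem slide_consRow_skewRow {j : ℕ} (hf : 2 ≤ f) (h0 : ∀ b, G 0 j = some b → x < b)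
    (h1 : ∀ b, G 0 (j + 1) = some b → X < b) (h2 : G 0 (j + 2) = none) :
    slide f 0 j (consRow (skewRow (j + 1) [x, X]) G) = consRow (skewRow j [x, X]) G := by
  obtain ⟨g, rfl⟩ : ∃ g, f = g + 1 + 1 := ⟨f - 2, by omega⟩
  rw [slide_right (a := x), slide_right (a := X), slide_stop]
  · funext i k
    cases i with
    | zero =>
      simp only [Filling.set, consRow, skewRow]
      rcases Nat.lt_or_ge k j with h | h
      · grind
      · obtain ⟨t, rfl⟩ := Nat.exists_eq_add_of_le h
        rcases t with _ | _ | t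
        · grind
        · grind
        · grind
    | succ i => simp [Filling.set, consRow]
  · simpa [Filling.set, consRow] using h2
  · simp only [Filling.set, consRow, skewRow]; grind
  · simp only [Filling.set, consRow, skewRow]; grind
  · intro b; simp only [Filling.set, consRow]; grind
  · simp [consRow, skewRow]
  · simpa [consRow] using h0

/-- After `x` has moved left, the hole lies between `X` on its right and `b` below it; the smaller
entry `b` moves up. -/
theorem above_slide_consRow_skewRow {b j : ℕ} (hf : 2 ≤ f) (h0 : ∀ b, G 0 j = some b → x < b)
    (h1 : G 0 (j + 1) = some b) (hb : b < X)
    (hu : ∀ i' j', G i' j' = some b → i' = 0 ∧ j' = j + 1) :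
    Above b 1 (slide f 0 j (consRow (skewRow (j + 1) [x, X]) G)) := by
  obtain ⟨g, rfl⟩ : ∃ g, f = g + 1 + 1 := ⟨f - 2, by omega⟩
  rw [slide_right (a := x), slide_down (b := b)]
  · apply Above.slide
    intro i k
    cases i with
    | zero => simp
    | succ i =>
      simp only [Filling.set, consRow]
      grind
  · simp only [Filling.set, consRow]; grind
  · simp only [Filling.set, consRow, skewRow]; grind
  · simp [consRow, skewRow]
  · simpa [consRow] using h0

/-- In these columns only the last entry of the row below can lie under the moving pair, and it
exceeds `x`; so each slide just shifts the pair by one. -/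
theorem foldl_slide_consRow_skewRow {e : ℕ} (r : ℕ) (hf : 2 ≤ f)
    (h0 : ∀ b, G 0 e = some b → x < b) (h1 : ∀ j, e < j → G 0 j = none) :
    (List.range (e + r)).reverse.foldl (fun F j => slide f 0 j F)
        (consRow (skewRow (e + r) [x, X]) G) =
      (List.range e).reverse.foldl (fun F j => slide f 0 j F) (consRow (skewRow e [x, X]) G) := by
  induction r with
  | zero => rfl
  | succ r ih =>
    rw [← Nat.add_assoc, List.range_succ, List.reverse_append, List.reverse_singleton,
      List.singleton_append, List.foldl_cons, slide_consRow_skewRow hf, ih]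
    · cases r with
      | zero => exact h0
      | succ r => intro b hb; rw [h1 _ (by omega)] at hb; simp at hb
    · intro b hb; rw [h1 _ (by omega)] at hb; simp at hb
    · exact h1 _ (by omega)

end FirstRow

section LargeTop

variable {f l₁ l₂ m N x : ℕ} {c d B : ℕ → ℕ}

/-- The filling `x, B 0` in columns `2` and `3`, above a two-column tableau. -/
def topTabTwo (l₁ l₂ m x : ℕ) (c d B : ℕ → ℕ) : Filling := fun i j =>
  if i = 0 then
    if j = 2 then some x else if j = 3 then some (B 0) else none
  else if i ≤ l₂ then
    if j = 0 then some (c (i - 1)) else if j = 1 then some (d (i - 1))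
    else if j = 2 then some (B i) else none
  else if i ≤ l₁ then
    if j = 0 then some (c (i - 1)) else if j = 1 then some (B i) else none
  else if i ≤ m then
    if j = 0 then some (B i) else none
  else none

theorem consRow_tab_two (l₁ l₂ m x : ℕ) (c d B : ℕ → ℕ) :
    consRow (skewRow 2 [x, B 0]) (tab l₁ l₂ m c d fun i => B (i + 1)) =
      topTabTwo l₁ l₂ m x c d B := by
  funext i j
  cases i with
  | zero =>
    rcases j with _ | _ | _ | _ | j <;> simp [consRow, skewRow, topTabTwo]
  | succ i =>
    simp only [consRow, tab, topTabTwo]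
    grind

/-- Since `d 0 < x`, the hole starts downwards in the second column and reaches its end, where `B
(l₂ + 1)` is the smaller neighbour. -/
theorem above_slide_topTabTwo (h21 : l₂ < l₁) (h1m : l₁ ≤ m) (h2 : 1 ≤ l₂)
    (hc : ∀ i < l₁, c i ≤ N) (hinj : ∀ i ≤ m, ∀ j ≤ m, B i = B j → i = j)
    (hd : ∀ i < l₂, d i ≤ N) (hB : ∀ i ≤ m, N < B i) (hx : d 0 < x)
    (hf : l₂ + 1 ≤ f) (hdes : B (l₂ + 1) < B l₂) :
    Above (B (l₂ + 1)) (l₂ + 1) (slide f 0 1 (topTabTwo l₁ l₂ m x c d B)) := by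
  obtain ⟨g, rfl⟩ : ∃ g, f = g + 1 + l₂ := ⟨f - l₂ - 1, by omega⟩
  have h0 : topTabTwo l₁ l₂ m x c d B 0 1 = none := by simp [topTabTwo]
  have := above_of_path (f := g) (d := l₂) (a := B l₂) (b := B (l₂ + 1)) h0 ?_ ?_ ?_ hdes ?_
  · simpa using this
  · intro t ht
    refine ⟨d t, ?_, ?_⟩
    · simp only [topTabTwo]; grind
    · have := hd t ht
      have := hB t (by omega)
      simp only [topTabTwo]; grind
  · simp only [topTabTwo]; grind
  · simp only [topTabTwo]; grind
  · intro i j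
    simp only [topTabTwo]
    grind

/-- Here the first slide is harmless and restores column `d` beside `c`; the second one runs down
the first column, and `B (l₁ + 1)` moves up at its end. -/
theorem above_slide_slide_topTabTwo (h21 : l₂ ≤ l₁) (h1m : l₁ < m) (h2 : 1 ≤ l₂)
    (hc : ∀ i < l₁, c i ≤ N) (hinj : ∀ i ≤ m, ∀ j ≤ m, B i = B j → i = j)
    (hd : ∀ i < l₂, d i ≤ N) (hxN : x ≤ N) (hB : ∀ i ≤ m, N < B i) (hx : d 0 < x)
    (hcd : ∀ i < l₂, c i < d i)
    (hf : l₁ + 2 ≤ f) (hdes : l₂ < l₁ → B l₂ < B (l₂ + 1)) (hdes' : B (l₁ + 1) < B l₁) :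
    Above (B (l₁ + 1)) (l₁ + 1)
      (slide f 0 0 (slide f 0 1 (topTabTwo l₁ l₂ m x c d B))) := by
  have key : slide f 0 1 (topTabTwo l₁ l₂ m x c d B) =
      ((colShift (topTabTwo l₁ l₂ m x c d B) 0 1 l₂).set l₂ 1 (some (B l₂))).set l₂ 2 none := by
    obtain ⟨g, rfl⟩ : ∃ g, f = g + 1 + l₂ := ⟨f - l₂ - 1, by omega⟩
    rw [slide_down_path, slide_right (a := B l₂), slide_stop]
    · simp
    · simp only [Filling.set, colShift, topTabTwo]; grind
    · simp only [Filling.set, colShift, topTabTwo]; grind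
    · simp only [colShift, topTabTwo]; grind
    · simp only [colShift, topTabTwo]; grind
    · simp [topTabTwo]
    · intro t ht
      refine ⟨d t, ?_, ?_⟩
      · simp only [topTabTwo]; grind
      · have := hd t ht
        have := hB t (by omega)
        simp only [topTabTwo]; grind
  rw [key]
  obtain ⟨g, rfl⟩ : ∃ g, f = g + 1 + l₁ := ⟨f - l₁ - 1, by omega⟩
  set F := ((colShift (topTabTwo l₁ l₂ m x c d B) 0 1 l₂).set l₂ 1 (some (B l₂))).set l₂ 2 none
    with hF
  have h0 : F 0 0 = none := by simp only [hF, Filling.set, colShift, topTabTwo]; grind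
  have := above_of_path (f := g) (d := l₁) (a := B l₁) (b := B (l₁ + 1)) h0 ?_ ?_ ?_ hdes' ?_
  · simpa using this
  · intro t ht
    refine ⟨c t, ?_, ?_⟩
    · simp only [hF, Filling.set, colShift, topTabTwo]; grind
    · have := hc t ht
      have := hB t (by omega)
      simp only [hF, Filling.set, colShift, topTabTwo]; grind
  · simp only [hF, Filling.set, colShift, topTabTwo]; grind
  · simp only [hF, Filling.set, colShift, topTabTwo]; grind
  · intro i j
    have := hB (l₁ + 1) (by omega)
    simp only [hF, Filling.set, colShift, topTabTwo]
    rcases j with _ | _ | _ | j <;> grind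

end LargeTop

/-! ### Row insertion into two-column tableaux -/

/-- The rows of the two-column tableau with columns `c` (of length `l₁`) and `d` (of length
`l₂`). -/
def colRows (l₁ l₂ : ℕ) (c d : ℕ → ℕ) : List (List ℕ) :=
  (List.range l₁).map fun i => if i < l₂ then [c i, d i] else [c i]

theorem colRows_succ (l₁ l₂ : ℕ) (c d : ℕ → ℕ) :
    colRows (l₁ + 1) l₂ c d = (if 0 < l₂ then [c 0, d 0] else [c 0]) ::
      colRows l₁ (l₂ - 1) (fun i => c (i + 1)) fun i => d (i + 1) := by
  simp only [colRows, List.range_succ_eq_map, List.map_cons, List.map_map, List.cons.injEq,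
    true_and]
  apply List.map_congr_left
  intro i _
  simp only [Function.comp, Nat.succ_eq_add_one]
  grind

theorem colRows_congr {l₁ l₂ : ℕ} {c d c' d' : ℕ → ℕ} (hc : ∀ i < l₁, c i = c' i)
    (hd : ∀ i < l₁, i < l₂ → d i = d' i) : colRows l₁ l₂ c d = colRows l₁ l₂ c' d' := by
  apply List.map_congr_left
  intro i hi
  rw [List.mem_range] at hi
  rw [hc i hi]
  split_ifs with h
  · rw [hd i hi h]
  · rfl

/-- Each `c i` is bumped into the next row and bumps `c (i + 1)`: the whole first column shifts
down. -/
theorem rowInsert_colRows_of_lt_zero {l₁ l₂ y : ℕ} {c d : ℕ → ℕ} (h21 : l₂ ≤ l₁)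
    (hy : 0 < l₁ → y < c 0) (hc : ∀ i, i + 1 < l₁ → c i < c (i + 1)) :
    rowInsert y (colRows l₁ l₂ c d) =
      (colRows (l₁ + 1) l₂ (fun i => if i = 0 then y else c (i - 1)) d, l₁) := by
  induction l₁ generalizing l₂ y c d with
  | zero =>
    obtain rfl : l₂ = 0 := by omega
    simp [colRows, rowInsert]
  | succ l₁ ih =>
    have hy := hy (by omega)
    have key := ih (l₂ := l₂ - 1) (y := c 0) (c := fun i => c (i + 1)) (d := fun i => d (i + 1))
      (by omega) (fun h => hc 0 (by omega)) fun i hi => hc (i + 1) (by omega)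
    rw [colRows_succ, colRows_succ]
    by_cases h : 0 < l₂
    all_goals
      first | rw [if_pos h, if_pos h] | rw [if_neg h, if_neg h]
      rw [rowInsert, insertIntoRow, if_pos hy]
      simp only [key, Prod.mk.injEq, List.cons.injEq, and_true, if_true, true_and]
      refine colRows_congr (fun i _ => ?_) fun i _ _ => rfl
      cases i <;> simp

/-- Bumping goes down the second column as long as `c i < D i`; in row `p` it switches to the first
column and pushes the rest of it down. -/
theorem rowInsert_colRows_of_lt {l₁ l₂ p : ℕ} {c D : ℕ → ℕ} (h21 : l₂ ≤ l₁) (hp2 : p ≤ l₂)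
    (hp : p < l₁ → D p < c p) (hcD : ∀ i < p, c i < D i)
    (hc : ∀ i, i + 1 < l₁ → c i < c (i + 1)) (hD : ∀ i < l₂, D i < D (i + 1)) :
    rowInsert (D 0) (colRows l₁ l₂ c fun i => D (i + 1)) =
      (colRows (l₁ + 1) l₂ (fun i => if i < p then c i else if i = p then D p else c (i - 1))
        (fun i => if i < p then D i else D (i + 1)), l₁) := by
  induction p generalizing l₁ l₂ c D with
  | zero =>
    rw [rowInsert_colRows_of_lt_zero h21 hp hc]
    simp
  | succ p ih =>
    obtain ⟨l₁, rfl⟩ : ∃ t, l₁ = t + 1 := ⟨l₁ - 1, by omega⟩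
    have key := ih (l₁ := l₁) (l₂ := l₂ - 1) (c := fun i => c (i + 1)) (D := fun i => D (i + 1))
      (by omega) (by omega) (fun h => hp (by omega)) (fun i hi => hcD (i + 1) (by omega))
      (fun i hi => hc (i + 1) (by omega)) fun i hi => hD (i + 1) (by omega)
    have h0 := hcD 0 (by omega)
    have h1 := hD 0 (by omega)
    rw [colRows_succ, if_pos (by omega), rowInsert, insertIntoRow, if_neg (by omega),
      insertIntoRow, if_pos h1]
    simp only [key]
    rw [colRows_succ (l₁ + 1), if_pos (by omega)]
    simp only [Nat.zero_lt_succ, if_true, Prod.mk.injEq, List.cons.injEq, true_and, and_true]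
    apply colRows_congr
    · intro i _
      rcases i with _ | i <;> grind
    · intro i _ _
      simp

/-- Bumping never leaves the second column, so the new cell is at its end. -/
theorem rowInsert_colRows_of_forall_lt {l₁ l₂ : ℕ} {c D : ℕ → ℕ} (h21 : l₂ < l₁)
    (hcD : ∀ i ≤ l₂, c i < D i) (hD : ∀ i < l₂, D i < D (i + 1)) :
    rowInsert (D 0) (colRows l₁ l₂ c fun i => D (i + 1)) = (colRows l₁ (l₂ + 1) c D, l₂) := by
  induction l₂ generalizing l₁ c D with
  | zero =>
    obtain ⟨l₁, rfl⟩ : ∃ t, l₁ = t + 1 := ⟨l₁ - 1, by omega⟩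
    have h0 := hcD 0 le_rfl
    rw [colRows_succ, if_neg (by omega), rowInsert, insertIntoRow, if_neg (by omega),
      insertIntoRow, colRows_succ, if_pos (by omega)]
    simp only [Prod.mk.injEq, List.cons.injEq, true_and, and_true]
    apply List.map_congr_left
    intro i _
    simp
  | succ l₂ ih =>
    obtain ⟨l₁, rfl⟩ : ∃ t, l₁ = t + 1 := ⟨l₁ - 1, by omega⟩
    have key := ih (l₁ := l₁) (c := fun i => c (i + 1)) (D := fun i => D (i + 1))
      (by omega) (fun i hi => hcD (i + 1) (by omega)) fun i hi => hD (i + 1) (by omega)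
    have h0 := hcD 0 (by omega)
    have h1 := hD 0 (by omega)
    rw [colRows_succ, if_pos (by omega), rowInsert, insertIntoRow, if_neg (by omega),
      insertIntoRow, if_pos h1]
    simp only [Nat.add_sub_cancel, key]
    rw [colRows_succ, if_pos (by omega)]
    rfl

theorem rowInsert_colRows_of_gt {l₁ l₂ x : ℕ} {c d : ℕ → ℕ} (h1 : 1 ≤ l₁) (h2 : 1 ≤ l₂)
    (hcd : c 0 < d 0) (hx : d 0 < x) : (rowInsert x (colRows l₁ l₂ c d)).2 = 0 := by
  obtain ⟨l₁, rfl⟩ : ∃ t, l₁ = t + 1 := ⟨l₁ - 1, by omega⟩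
  rw [colRows_succ, if_pos (by omega), rowInsert, insertIntoRow, if_neg (by omega), insertIntoRow,
    if_neg (by omega), insertIntoRow]

/-! ### Row sequences -/

theorem rsk_append_singleton (u : List ℕ) (x : ℕ) :
    rsk (u ++ [x]) = ((rowInsert x (rsk u).1).1,
      addCell (u.length + 1) (rowInsert x (rsk u).1).2 (rsk u).2) := by
  simp [rsk, List.zipIdx_append, Nat.add_comm]

/-- The word `v 0, …, v (m - 1)`. -/
def prefixWord (v : ℕ → ℕ) (m : ℕ) : List ℕ := (List.range m).map v

theorem prefixWord_succ (v : ℕ → ℕ) (m : ℕ) :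
    prefixWord v (m + 1) = prefixWord v m ++ [v m] := by
  simp [prefixWord, List.range_succ]

/-- The row of the cell that the insertion of `v m` adds. -/
def newRow (v : ℕ → ℕ) (m : ℕ) : ℕ := (rowInsert (v m) (rsk (prefixWord v m)).1).2

theorem rsk_prefixWord_succ (v : ℕ → ℕ) (m : ℕ) :
    rsk (prefixWord v (m + 1)) = ((rowInsert (v m) (rsk (prefixWord v m)).1).1,
      addCell (m + 1) (newRow v m) (rsk (prefixWord v m)).2) := by
  rw [prefixWord_succ, rsk_append_singleton]
  simp [newRow, prefixWord]

theorem length_rowInsert (x : ℕ) (P : List (List ℕ)) : (rowInsert x P).2 ≤ P.length ∧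
    (rowInsert x P).1.length = P.length + if (rowInsert x P).2 = P.length then 1 else 0 := by
  induction P generalizing x with
  | nil => simp [rowInsert]
  | cons r P ih =>
    rw [rowInsert]
    rcases h : insertIntoRow x r with ⟨r', _ | y⟩
    · simp
    · have := ih y
      simp only [List.length_cons, Nat.add_right_cancel_iff]
      omega

theorem length_addCell {t i : ℕ} {Q : List (List ℕ)} (hi : i ≤ Q.length) :
    (addCell t i Q).length = Q.length + if i = Q.length then 1 else 0 := by
  induction Q generalizing i with
  | nil => simp only [List.length_nil] at hi ⊢; simp [addCell, Nat.le_zero.mp hi]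
  | cons r Q ih =>
    cases i with
    | zero => simp [addCell]
    | succ i =>
      simp only [List.length_cons, Nat.add_le_add_iff_right] at hi
      have := ih hi
      simp only [addCell, List.length_cons, Nat.add_right_cancel_iff]
      omega

theorem mem_addCell_self {t i : ℕ} {Q : List (List ℕ)} (hi : i ≤ Q.length) :
    ∃ r, (addCell t i Q)[i]? = some r ∧ t ∈ r := by
  induction Q generalizing i with
  | nil => simp only [List.length_nil, Nat.le_zero] at hi; simp [addCell, hi]
  | cons r Q ih =>
    cases i with
    | zero => simp [addCell]
    | succ i =>
      simp only [List.length_cons, Nat.add_le_add_iff_right] at hi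
      simpa [addCell] using ih hi

theorem mem_addCell_of_mem {t i j x : ℕ} {Q : List (List ℕ)}
    (h : ∃ r, Q[j]? = some r ∧ x ∈ r) : ∃ r, (addCell t i Q)[j]? = some r ∧ x ∈ r := by
  induction Q generalizing i j with
  | nil => simp at h
  | cons r Q ih =>
    cases i with
    | zero =>
      cases j with
      | zero => simp at h; simp [addCell, h]
      | succ j => simpa [addCell] using h
    | succ i =>
      cases j with
      | zero => simpa [addCell] using h
      | succ j => simp only [addCell, List.getElem?_cons_succ] at h ⊢; exact ih h

theorem length_rsk (v : ℕ → ℕ) (m : ℕ) :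
    (rsk (prefixWord v m)).2.length = (rsk (prefixWord v m)).1.length := by
  induction m with
  | zero => rfl
  | succ m ih =>
    have h := length_rowInsert (v m) (rsk (prefixWord v m)).1
    rw [rsk_prefixWord_succ]
    simp only
    rw [length_addCell (ih ▸ h.1), h.2, ih]
    rfl

theorem mem_recording (v : ℕ → ℕ) {m t : ℕ} (ht : t < m) :
    ∃ r, (rsk (prefixWord v m)).2[newRow v t]? = some r ∧ t + 1 ∈ r := by
  induction m with
  | zero => omega
  | succ m ih =>
    rw [rsk_prefixWord_succ]
    rcases Nat.lt_succ_iff_lt_or_eq.mp ht with h | rfl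
    · exact mem_addCell_of_mem (ih h)
    · apply mem_addCell_self
      rw [length_rsk]
      exact (length_rowInsert _ _).1

/-- The row of the entry `t + 1` in the tableau `T_k`. -/
def twoColumnRow (k t : ℕ) : ℕ := if t < k then t else t - k

theorem addCell_eq (t : ℕ) (Q : List (List ℕ)) : addCell t Q.length Q = Q ++ [[t]] := by
  induction Q with
  | nil => rfl
  | cons r Q ih => simp [addCell, ih]

theorem addCell_append (t : ℕ) (Q Q' : List (List ℕ)) (r : List ℕ) :
    addCell t Q.length (Q ++ r :: Q') = Q ++ (r ++ [t]) :: Q' := by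
  induction Q with
  | nil => rfl
  | cons r Q ih => simp [addCell, ih]

theorem row_eq_of_mem_twoColumnTableau {n k i t : ℕ} {r : List ℕ} (hk : 1 ≤ k) (hkn : k ≤ n)
    (h : (twoColumnTableau n k)[i]? = some r) (ht : t + 1 ∈ r) : i = twoColumnRow k t := by
  unfold twoColumnTableau at h
  unfold twoColumnRow
  split_ifs at h with h1 <;>
  · rw [List.getElem?_append] at h
    simp only [List.length_map, List.length_range] at h
    split_ifs at h with h2
    · rw [List.getElem?_map, List.getElem?_range h2] at h
      simp only [Option.map_some, Option.some.injEq] at h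
      subst h
      simp only [List.mem_cons, List.not_mem_nil, or_false] at ht
      grind
    · rw [List.getElem?_map] at h
      rcases Nat.lt_or_ge (i - (n - k)) (2 * k - n) with h3 | h3 <;>
      rcases Nat.lt_or_ge (i - k) (n - 2 * k) with h4 | h4 <;>
      simp [h3, h4] at h <;>
      · subst h
        simp only [List.mem_cons, List.not_mem_nil, or_false] at ht
        grind

theorem twoColumnTableau_succ {m k : ℕ} (hkm : k ≤ m) :
    addCell (m + 1) (m - k) (twoColumnTableau m k) = twoColumnTableau (m + 1) k := by
  unfold twoColumnTableau
  rcases Nat.lt_or_ge m (2 * k) with h | h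
  · rw [if_neg (by omega)]
    have e : addCell (m + 1) (m - k)
        ((List.range (m - k)).map (fun i => [i + 1, k + 1 + i]) ++
          (List.range (2 * k - m)).map (fun i => [m - k + 1 + i])) =
        (List.range (m - k + 1)).map (fun i => [i + 1, k + 1 + i]) ++
          (List.range (2 * k - m - 1)).map (fun i => [m - k + 1 + (i + 1)]) := by
      obtain ⟨t, ht⟩ : ∃ t, 2 * k - m = t + 1 := ⟨2 * k - m - 1, by omega⟩
      rw [ht, List.range_succ_eq_map, List.map_cons]
      have := addCell_append (m + 1) ((List.range (m - k)).map (fun i => [i + 1, k + 1 + i]))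
      simp only [List.length_map, List.length_range] at this
      rw [this, List.range_succ]
      simp
      omega
    rw [e]
    split_ifs with h1
    · have : m + 1 = 2 * k := by omega
      rw [show m - k + 1 = k by omega, show 2 * k - m - 1 = 0 by omega,
        show m + 1 - 2 * k = 0 by omega]
      rfl
    · rw [show m + 1 - k = m - k + 1 by omega, show 2 * k - m - 1 = 2 * k - (m + 1) by omega]
      congr 1
      apply List.map_congr_left
      intros
      simp; omega
  · rw [if_pos h, if_pos (by omega)]
    have := addCell_eq (m + 1) ((List.range k).map (fun i => [i + 1, k + 1 + i]) ++
      (List.range (m - 2 * k)).map (fun i => [2 * k + 1 + i]))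
    simp only [List.length_append, List.length_map, List.length_range] at this
    rw [show m - k = k + (m - 2 * k) by omega, this,
      show m + 1 - 2 * k = m - 2 * k + 1 by omega, List.range_succ]
    simp
    omega

theorem twoColumnTableau_self_succ (m : ℕ) (hm : 1 ≤ m) :
    addCell (m + 1) m (twoColumnTableau m m) = twoColumnTableau (m + 1) (m + 1) := by
  unfold twoColumnTableau
  rw [if_neg (by omega), if_neg (by omega)]
  have := addCell_eq (m + 1) ((List.range (2 * m - m)).map (fun i => [m - m + 1 + i]))
  simp only [List.length_map, List.length_range] at this
  rw [show 2 * m - m = m by omega] at *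
  simp only [Nat.sub_self, List.range_zero, List.map_nil, List.nil_append]
  simp only [Nat.sub_self] at this
  rw [this, show 2 * (m + 1) - (m + 1) = m + 1 by omega, List.range_succ]
  simp
  omega

/-- The entries up to `m` of `T_k` form `T_{min k m}` of size `m`; stated for prefixes, so that
induction on `m` applies. -/
theorem recording_eq_of_newRow {v : ℕ → ℕ} {m k : ℕ} (hk : 1 ≤ k) (hm : 1 ≤ m)
    (h : ∀ t < m, newRow v t = twoColumnRow k t) :
    (rsk (prefixWord v m)).2 = twoColumnTableau m (min k m) := by
  induction m with
  | zero => omega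
  | succ m ih =>
    rw [rsk_prefixWord_succ, h m (by omega)]
    rcases Nat.eq_zero_or_pos m with rfl | hm
    · rw [show min k (0 + 1) = 1 by omega]
      simp [prefixWord, rsk, twoColumnRow, addCell, twoColumnTableau]
    · simp only [twoColumnRow]
      rw [ih hm fun t ht => h t (by omega)]
      split_ifs with h1
      · rw [show min k m = m by omega, show min k (m + 1) = m + 1 by omega,
          twoColumnTableau_self_succ m hm]
      · rw [show min k m = k by omega, show min k (m + 1) = k by omega,
          twoColumnTableau_succ (by omega)]

/-- A recording tableau is determined by the rows in which its entries lie. -/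
theorem recording_eq_iff {v : ℕ → ℕ} {n k : ℕ} (hk : 1 ≤ k) (hkn : k ≤ n) :
    (rsk (prefixWord v n)).2 = twoColumnTableau n k ↔
      ∀ t < n, newRow v t = twoColumnRow k t := by
  constructor
  · intro h t ht
    obtain ⟨r, hr, htr⟩ := mem_recording v ht
    rw [h] at hr
    exact row_eq_of_mem_twoColumnTableau hk hkn hr htr
  · intro h
    rw [recording_eq_of_newRow hk (hk.trans hkn) h, min_eq_left hkn]

/-! ### Rectification and insertion, one letter at a time -/

/-- The rows of `T(w)^(2)` that belong to the first `m` letters. -/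
def stackTwo (N : ℕ) (v : ℕ → ℕ) : ℕ → SkewRows
  | 0 => []
  | m + 1 => (m, [v m, v m + N]) :: stackTwo N v m

/-- The sequence `x, d 0, d 1, …`. -/
def consSeq (x : ℕ) (d : ℕ → ℕ) : ℕ → ℕ
  | 0 => x
  | i + 1 => d i

/-- The columns `c` (of length `l₁`) and `d` (of length `l₂`) form a tableau whose entries are
letters among `v 0, …, v (m - 1)`. -/
structure IsColumnPair (v : ℕ → ℕ) (m l₁ l₂ : ℕ) (c d : ℕ → ℕ) : Prop where
  le : l₂ ≤ l₁
  size : l₁ + l₂ = m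
  c_lt : ∀ i j, i < j → j < l₁ → c i < c j
  d_lt : ∀ i j, i < j → j < l₂ → d i < d j
  c_lt_d : ∀ i < l₂, c i < d i
  c_mem : ∀ i < l₁, ∃ t < m, c i = v t
  d_mem : ∀ i < l₂, ∃ t < m, d i = v t
  c_ne_d : ∀ i < l₁, ∀ j < l₂, c i ≠ d j

/-- Both the rectification and the insertion tableau of the first `m` letters have columns
`c` and `d`, and no large entry has moved up. -/
structure IsState (f N : ℕ) (v : ℕ → ℕ) (m l₁ l₂ : ℕ) (c d : ℕ → ℕ) : Prop
    extends IsColumnPair v m l₁ l₂ c d where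
  rect : rectFuel f (stackTwo N v m) = tab l₁ l₂ m c d fun i => v (m - 1 - i) + N
  ins : (rsk (prefixWord v m)).1 = colRows l₁ l₂ c d

/-- The letters `v 0, …, v (n - 1)` are distinct and lie between `1` and `N`. -/
structure IsWord (v : ℕ → ℕ) (n N : ℕ) : Prop where
  pos : ∀ i < n, 1 ≤ v i
  le : ∀ i < n, v i ≤ N
  inj : ∀ i < n, ∀ j < n, v i = v j → i = j

/-! ### Effect of one insertion on a pair of columns -/

section Step

variable {f N n m l₁ l₂ p : ℕ} {v c d : ℕ → ℕ}

theorem consSeq_lt (h : IsColumnPair v m l₁ l₂ c d) (hx : 0 < l₂ → v m < d 0) :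
    ∀ i j, i < j → j ≤ l₂ → consSeq (v m) d i < consSeq (v m) d j := by
  intro i j hij hj
  obtain ⟨j, rfl⟩ : ∃ t, j = t + 1 := ⟨j - 1, by omega⟩
  cases i with
  | zero =>
    rcases Nat.eq_zero_or_pos j with rfl | h0
    · exact hx (by omega)
    · exact (hx (by omega)).trans (h.d_lt 0 j h0 (by omega))
  | succ i => exact h.d_lt i j (by omega) (by omega)

theorem consSeq_mem (h : IsColumnPair v m l₁ l₂ c d) :
    ∀ i ≤ l₂, ∃ t < m + 1, consSeq (v m) d i = v t := by
  intro i hi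
  cases i with
  | zero => exact ⟨m, by omega, rfl⟩
  | succ i =>
    obtain ⟨t, ht, e⟩ := h.d_mem i (by omega)
    exact ⟨t, by omega, e⟩

theorem ne_consSeq (h : IsColumnPair v m l₁ l₂ c d) (hv : IsWord v n N) (hm : m < n) :
    ∀ i < l₁, ∀ j ≤ l₂, c i ≠ consSeq (v m) d j := by
  intro i hi j hj
  cases j with
  | zero =>
    obtain ⟨t, ht, e⟩ := h.c_mem i hi
    intro h'
    rw [e] at h'
    have := hv.inj t (by omega) m hm h'
    omega
  | succ j => exact h.c_ne_d i hi j (by omega)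

theorem IsColumnPair.of_forall_lt (h : IsColumnPair v m l₁ l₂ c d) (hv : IsWord v n N)
    (hm : m < n) (hx : 0 < l₂ → v m < d 0) (h21 : l₂ < l₁)
    (hcD : ∀ i ≤ l₂, c i < consSeq (v m) d i) :
    IsColumnPair v (m + 1) l₁ (l₂ + 1) c (consSeq (v m) d) where
  le := h21
  size := by have := h.size; omega
  c_lt := h.c_lt
  d_lt := fun i j hij hj => consSeq_lt h hx i j hij (by omega)
  c_lt_d := fun i hi => hcD i (by omega)
  c_mem := fun i hi => (h.c_mem i hi).imp fun t ht => ⟨by omega, ht.2⟩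
  d_mem := fun i hi => consSeq_mem h i (by omega)
  c_ne_d := fun i hi j hj => ne_consSeq h hv hm i hi j (by omega)

theorem IsColumnPair.of_lt (h : IsColumnPair v m l₁ l₂ c d) (hv : IsWord v n N)
    (hm : m < n) (hx : 0 < l₂ → v m < d 0) (hp2 : p ≤ l₂)
    (hp : p < l₁ → consSeq (v m) d p < c p) (hcD : ∀ i < p, c i < consSeq (v m) d i) :
    IsColumnPair v (m + 1) (l₁ + 1) l₂
      (fun i => if i < p then c i else if i = p then consSeq (v m) d p else c (i - 1))
      (fun i => if i < p then consSeq (v m) d i else consSeq (v m) d (i + 1)) := by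
  have hlt := consSeq_lt h hx
  have hmem := consSeq_mem h
  have hne := ne_consSeq h hv hm
  have hcd : ∀ i < l₂, c i < consSeq (v m) d (i + 1) := h.c_lt_d
  have hc := h.c_lt
  have hle := h.le
  have hcmem : ∀ i < l₁, ∃ t < m + 1, c i = v t :=
    fun i hi => (h.c_mem i hi).imp fun t ht => ⟨by omega, ht.2⟩
  generalize consSeq (v m) d = D at *
  refine ⟨by omega, by have := h.size; omega, ?_, ?_, ?_, ?_, ?_, ?_⟩
  · intro i j hij hj
    split_ifs with h1 h2 h3 h4 h5 h6 h7 h8 <;> try omega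
    · exact hc i j hij (by omega)
    · exact (hcD i h1).trans (hlt i p h1 hp2)
    · rcases Nat.lt_or_ge i (j - 1) with h9 | h9
      · exact hc i (j - 1) h9 (by omega)
      · omega
    · rcases Nat.lt_or_ge p (j - 1) with h9 | h9
      · exact (hp (by omega)).trans (hc p (j - 1) h9 (by omega))
      · rw [show j - 1 = p by omega]; exact hp (by omega)
    · exact hc (i - 1) (j - 1) (by omega) (by omega)
  · intro i j hij hj
    split_ifs <;> try omega
    · exact hlt i j hij (by omega)
    · exact hlt i (j + 1) (by omega) (by omega)
    · exact hlt (i + 1) (j + 1) (by omega) (by omega)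
  · intro i hi
    split_ifs with h1 h2
    · exact hcD i h1
    · exact hlt p (i + 1) (by omega) (by omega)
    · exact (hc (i - 1) i (by omega) (by omega)).trans (hcd i hi)
  · intro i hi
    split_ifs
    · exact hcmem i (by omega)
    · exact hmem p hp2
    · exact hcmem _ (by omega)
  · intro i hi
    split_ifs
    · exact hmem i (by omega)
    · exact hmem _ (by omega)
  · intro i hi j hj
    split_ifs
    · exact hne i (by omega) j (by omega)
    · exact hne i (by omega) (j + 1) (by omega)
    · exact (hlt j p (by omega) hp2).ne'
    · exact (hlt p (j + 1) (by omega) (by omega)).ne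
    · exact hne _ (by omega) j (by omega)
    · exact hne _ (by omega) (j + 1) (by omega)

end Step

/-! ### Effect of one more row on the rectification -/

section Step

variable {f N n m l₁ l₂ p : ℕ} {v c d : ℕ → ℕ}

theorem foldl_reverse_range_two {α : Type*} (g : α → ℕ → α) (a : α) :
    (List.range 2).reverse.foldl g a = g (g a 1) 0 := rfl

theorem IsState.rectFuel_succ (h : IsState f N v m l₁ l₂ c d) :
    rectFuel f (stackTwo N v (m + 1)) = (List.range m).reverse.foldl (fun F j => slide f 0 j F)
      (consRow (skewRow m [v m, v m + N]) (tab l₁ l₂ m c d fun i => v (m - 1 - i) + N)) := by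
  rw [stackTwo, rectFuel_cons, h.rect]

/-- With this indexing the large entries of the old rows and of the new top row form a single
sequence `B i = v (m - i) + N`. -/
theorem tab_shift (l₁ l₂ m N : ℕ) (v c d : ℕ → ℕ) :
    tab l₁ l₂ m c d (fun i => v (m - 1 - i) + N) =
      tab l₁ l₂ m c d fun i => v (m - (i + 1)) + N := by
  simp only [Nat.sub_sub, Nat.add_comm 1]

theorem IsWord.lt_add (hv : IsWord v n N) {i j : ℕ} (hi : i < n) (hj : j < n) :
    v i < v j + N := by
  have := hv.pos j hj
  have := hv.le i hi
  omega

theorem IsWord.add_inj (hv : IsWord v n N) (hm : m < n) :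
    ∀ i ≤ m, ∀ j ≤ m, v (m - i) + N = v (m - j) + N → i = j := by
  intro i hi j hj h
  have := hv.inj (m - i) (by omega) (m - j) (by omega) (by omega)
  omega

theorem IsState.c_le (h : IsState f N v m l₁ l₂ c d) (hv : IsWord v n N) (hm : m ≤ n) :
    ∀ i < l₁, c i ≤ N := by
  intro i hi
  obtain ⟨t, ht, e⟩ := h.c_mem i hi
  rw [e]; exact hv.le t (by omega)

theorem IsState.d_le (h : IsState f N v m l₁ l₂ c d) (hv : IsWord v n N) (hm : m ≤ n) :
    ∀ i < l₂, d i ≤ N := by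
  intro i hi
  obtain ⟨t, ht, e⟩ := h.d_mem i hi
  rw [e]; exact hv.le t (by omega)

theorem IsState.consSeq_le (h : IsState f N v m l₁ l₂ c d) (hv : IsWord v n N) (hm : m < n) :
    ∀ i ≤ l₂, consSeq (v m) d i ≤ N := by
  intro i hi
  obtain ⟨t, ht, e⟩ := consSeq_mem h.toIsColumnPair i hi
  rw [e]; exact hv.le t (by omega)

theorem IsWord.lt_large (hv : IsWord v n N) (hm : m < n) : ∀ i ≤ m, N < v (m - i) + N := by
  intro i _
  have := hv.pos (m - i) (by omega)
  omega

/-- If the second column is not empty, the slides before the last two move the new row to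
columns `2` and `3`. -/
theorem IsState.rectFuel_succ_two (h : IsState f N v m l₁ l₂ c d) (hv : IsWord v n N) (hm : m < n)
    (hf : m + 2 ≤ f) (h2 : 0 < l₂) :
    rectFuel f (stackTwo N v (m + 1)) = slide f 0 0 (slide f 0 1
      (consRow (skewRow 2 [v m, v m + N]) (tab l₁ l₂ m c d fun i => v (m - 1 - i) + N))) := by
  have := h.le
  have := h.size
  rw [h.rectFuel_succ]
  obtain ⟨r, rfl⟩ : ∃ r, m = 2 + r := ⟨m - 2, by omega⟩
  rw [foldl_slide_consRow_skewRow r (by omega), foldl_reverse_range_two]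
  · intro b hb
    have := hv.lt_add (i := 2 + r) (j := 2 + r - 1 - 0) (by omega) (by omega)
    simp only [tab, if_pos h2] at hb
    simp only [OfNat.ofNat_ne_zero, OfNat.ofNat_ne_one, if_false, if_true, Option.some.injEq] at hb
    omega
  · intro j hj
    simp only [tab, if_pos h2]
    rw [if_neg (by omega), if_neg (by omega), if_neg (by omega)]

/-- All slides but the last move the new row to columns `1` and `2`. -/
theorem IsState.rectFuel_succ_one (h : IsState f N v m l₁ l₂ c d) (hv : IsWord v n N) (hm : m < n)
    (hm1 : 1 ≤ m) (hf : m + 2 ≤ f) (hx : 0 < l₂ → v m < d 0 ∧ v m < v (m - 1)) :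
    rectFuel f (stackTwo N v (m + 1)) =
      slide f 0 0 (topTab l₁ l₂ m c (consSeq (v m) d) fun i => v (m - i) + N) := by
  have hle := h.le
  have hsize := h.size
  rw [← consRow_tab, ← tab_shift]
  rcases Nat.eq_zero_or_pos l₂ with rfl | h2
  · rw [h.rectFuel_succ]
    obtain ⟨r, rfl⟩ : ∃ r, m = 1 + r := ⟨m - 1, by omega⟩
    rw [foldl_slide_consRow_skewRow r (by omega)]
    · rfl
    · intro b hb
      have := hv.lt_add (i := 1 + r) (j := r) (by omega) (by omega)
      simp only [tab] at hb
      rw [if_neg (by omega), if_pos (by omega)] at hb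
      simp at hb
      omega
    · intro j hj
      simp only [tab]
      rw [if_neg (by omega), if_pos (by omega), if_neg (by omega), if_neg (by omega)]
  -- The two halves of `hx` are the two comparisons in this slide: `v m` with `d 0`, and `v m + N`
  -- with `v (m - 1) + N`.
  · rw [h.rectFuel_succ_two hv hm hf h2, slide_consRow_skewRow (j := 1) (by omega)]
    · rfl
    · intro b hb
      simp only [tab, if_pos h2] at hb
      simp at hb
      have := (hx h2).1
      omega
    · intro b hb
      simp only [tab, if_pos h2] at hb
      simp at hb
      have := (hx h2).2
      omega
    · simp only [tab, if_pos h2]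
      simp

/-- Insertion that ends in the second column. -/
theorem IsState.of_forall_lt (h : IsState f N v m l₁ l₂ c d) (hv : IsWord v n N) (hm : m < n)
    (hm1 : 1 ≤ m) (hf : m + 2 ≤ f) (hx : 0 < l₂ → v m < d 0 ∧ v m < v (m - 1))
    (h21 : l₂ < l₁) (hcD : ∀ i ≤ l₂, c i < consSeq (v m) d i)
    (hdes : 0 < l₂ → v (m - l₁) < v (m - 1 - l₁)) :
    IsState f N v (m + 1) l₁ (l₂ + 1) c (consSeq (v m) d) ∧ newRow v m = l₂ := by
  have hsize := h.size
  have hins := rowInsert_colRows_of_forall_lt (D := consSeq (v m) d) h21 hcD fun i hi =>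
    consSeq_lt h.toIsColumnPair (fun h' => (hx h').1) i (i + 1) (by omega) (by omega)
  refine ⟨⟨h.toIsColumnPair.of_forall_lt hv hm (fun h' => (hx h').1) h21 hcD, ?_, ?_⟩, ?_⟩
  · rw [h.rectFuel_succ_one hv hm hm1 hf hx,
      slide_topTab_of_forall_lt h21 (by omega) (h.c_le hv hm.le) (hv.lt_large hm) hcD (by omega)]
    · rfl
    -- Since `m = l₁ + l₂`, there is a row below row `l₁` only if `l₂ > 0`.
    · intro h'
      have := hdes (by omega)
      rw [Nat.sub_sub, Nat.add_comm 1] at this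
      simpa using this
  · rw [rsk_prefixWord_succ, h.ins]; exact congrArg Prod.fst hins
  · rw [newRow, h.ins]; exact congrArg Prod.snd hins

theorem IsState.newRow_of_lt (h : IsState f N v m l₁ l₂ c d)
    (hx : 0 < l₂ → v m < d 0) (hp2 : p ≤ l₂)
    (hp : p < l₁ → consSeq (v m) d p < c p) (hcD : ∀ i < p, c i < consSeq (v m) d i) :
    newRow v m = l₁ := by
  rw [newRow, h.ins]
  exact congrArg Prod.snd (rowInsert_colRows_of_lt (D := consSeq (v m) d) h.le hp2 hp hcD
    (fun i hi => h.c_lt i (i + 1) (by omega) hi) fun i hi =>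
      consSeq_lt h.toIsColumnPair hx i (i + 1) (by omega) (by omega))

/-- Insertion that ends in the first column. -/
theorem IsState.of_lt (h : IsState f N v m l₁ l₂ c d) (hv : IsWord v n N) (hm : m < n)
    (hm1 : 1 ≤ m) (hf : m + 2 ≤ f) (hx : 0 < l₂ → v m < d 0 ∧ v m < v (m - 1)) (hp2 : p ≤ l₂)
    (hp : p < l₁ → consSeq (v m) d p < c p) (hcD : ∀ i < p, c i < consSeq (v m) d i)
    (hdes : l₂ < l₁ → v (m - l₂) < v (m - 1 - l₂)) :
    IsState f N v (m + 1) (l₁ + 1) l₂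
      (fun i => if i < p then c i else if i = p then consSeq (v m) d p else c (i - 1))
      (fun i => if i < p then consSeq (v m) d i else consSeq (v m) d (i + 1)) ∧
    newRow v m = l₁ := by
  have hsize := h.size
  have hle := h.le
  refine ⟨⟨h.toIsColumnPair.of_lt hv hm (fun h' => (hx h').1) hp2 hp hcD, ?_, ?_⟩,
    h.newRow_of_lt (fun h' => (hx h').1) hp2 hp hcD⟩
  · rw [h.rectFuel_succ_one hv hm hm1 hf hx,
      slide_topTab_of_lt (by omega) hp2 (by omega) hle (h.consSeq_le hv hm) (hv.lt_large hm) hcD hp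
        (by omega)]
    · rfl
    · intro h'
      have := hdes h'
      rw [Nat.sub_sub, Nat.add_comm 1] at this
      simpa using this
  · rw [rsk_prefixWord_succ, h.ins]
    exact congrArg Prod.fst (rowInsert_colRows_of_lt (D := consSeq (v m) d) h.le hp2 hp hcD
      (fun i hi => h.c_lt i (i + 1) (by omega) hi) fun i hi =>
        consSeq_lt h.toIsColumnPair (fun h' => (hx h').1) i (i + 1) (by omega) (by omega))

/-- Some large entry has moved up. -/
def HasMovedUp (f N : ℕ) (v : ℕ → ℕ) (m : ℕ) : Prop :=
  ∃ t < m, Above (v t + N) (m - 1 - t) (rectFuel f (stackTwo N v m))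

theorem HasMovedUp.succ (h : HasMovedUp f N v m) :
    HasMovedUp f N v (m + 1) := by
  obtain ⟨t, ht, h⟩ := h
  refine ⟨t, by omega, ?_⟩
  rw [stackTwo, rectFuel_cons]
  apply Above.foldl_slide
  intro i j hij
  cases i with
  | zero => omega
  | succ i =>
    have := h i j hij
    omega

theorem hasMovedUp_of_above {g : ℕ} (hg : 1 ≤ g) (hgm : g ≤ m)
    (h : Above (v (m - g) + N) g (rectFuel f (stackTwo N v (m + 1)))) :
    HasMovedUp f N v (m + 1) := by
  refine ⟨m - g, by omega, ?_⟩
  rwa [show m + 1 - 1 - (m - g) = g by omega]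

/-- The hole of the last slide ends in the first of two rows that become equally long, at the end of
the second column. -/
theorem IsState.hasMovedUp_of_lt (h : IsState f N v m l₁ l₂ c d) (hv : IsWord v n N) (hm : m < n)
    (hm1 : 1 ≤ m) (hf : m + 2 ≤ f) (hx : 0 < l₂ → v m < d 0 ∧ v m < v (m - 1)) (hp2 : p ≤ l₂)
    (hp : p < l₁ → consSeq (v m) d p < c p) (hcD : ∀ i < p, c i < consSeq (v m) d i)
    (h21 : l₂ < l₁) (hdes : v (m - 1 - l₂) < v (m - l₂)) :
    HasMovedUp f N v (m + 1) := by
  have hsize := h.size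
  rw [Nat.sub_sub, Nat.add_comm 1] at hdes
  apply hasMovedUp_of_above (g := l₂ + 1) (by omega) (by omega)
  rw [h.rectFuel_succ_one hv hm hm1 hf hx]
  exact above_slide_topTab_of_lt (B := fun i => v (m - i) + N) (by omega) hp2 h21
    (h.c_le hv hm.le) (hv.add_inj hm) (h.consSeq_le hv hm) (hv.lt_large hm) hcD hp (by omega)
    (by simpa using hdes)

/-- In the slide into `(0, 1)` the letter `v m` moves left, being smaller than `d 0`; the hole then
has `v m + N` on its right and the smaller `v (m - 1) + N` below it. -/
theorem IsState.hasMovedUp_of_between (h : IsState f N v m l₁ l₂ c d) (hv : IsWord v n N)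
    (hm : m < n) (hf : m + 2 ≤ f) (h2 : 0 < l₂) (hx : v m < d 0)
    (hx' : v (m - 1) < v m) : HasMovedUp f N v (m + 1) := by
  have hsize := h.size
  have hle := h.le
  apply hasMovedUp_of_above (g := 1) (by omega) (by omega)
  rw [h.rectFuel_succ_two hv hm hf h2]
  apply Above.slide
  apply above_slide_consRow_skewRow (by omega)
  · intro b hb
    simp only [tab, if_pos h2] at hb
    simp at hb
    omega
  · simp only [tab, if_pos h2]; simp
  · omega
  · intro i j hij
    have h3 := h.c_le hv hm.le i
    have h4 := h.d_le hv hm.le i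
    have h5 := hv.pos (m - 1) (by omega)
    have h6 : v (m - 1 - i) = v (m - 1) → i < m → i = 0 := by
      intro h6 h7
      have := hv.inj (m - 1 - i) (by omega) (m - 1) (by omega) h6
      omega
    simp only [tab] at hij
    grind

/-- The alternatives in `hdes` say which slide lifts a large entry: the one into `(0, 1)`, ending in
row `l₂`, or else the one into `(0, 0)`, ending in row `l₁`. -/
theorem IsState.hasMovedUp_of_gt (h : IsState f N v m l₁ l₂ c d) (hv : IsWord v n N)
    (hm : m < n) (hf : m + 2 ≤ f) (h2 : 0 < l₂) (hx : d 0 < v m)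
    (hdes : (l₂ < l₁ ∧ v (m - 1 - l₂) < v (m - l₂)) ∨
      ((l₂ < l₁ → v (m - l₂) < v (m - 1 - l₂)) ∧ v (m - 1 - l₁) < v (m - l₁))) :
    HasMovedUp f N v (m + 1) := by
  have hsize := h.size
  have hle := h.le
  simp only [Nat.sub_sub, Nat.add_comm 1] at hdes
  have e : consRow (skewRow 2 [v m, v m + N]) (tab l₁ l₂ m c d fun i => v (m - 1 - i) + N) =
      topTabTwo l₁ l₂ m (v m) c d fun i => v (m - i) + N := by
    rw [← consRow_tab_two, ← tab_shift]; rfl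
  rcases hdes with ⟨h21, hdes⟩ | ⟨hdes, hdes'⟩
  · apply hasMovedUp_of_above (g := l₂ + 1) (by omega) (by omega)
    rw [h.rectFuel_succ_two hv hm hf h2, e]
    apply Above.slide
    exact above_slide_topTabTwo (B := fun i => v (m - i) + N) h21 (by omega) h2 (h.c_le hv hm.le)
      (hv.add_inj hm) (h.d_le hv hm.le) (hv.lt_large hm) hx (by omega) (by simpa using hdes)
  · apply hasMovedUp_of_above (g := l₁ + 1) (by omega) (by omega)
    rw [h.rectFuel_succ_two hv hm hf h2, e]
    exact above_slide_slide_topTabTwo (B := fun i => v (m - i) + N) hle (by omega) h2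
      (h.c_le hv hm.le) (hv.add_inj hm) (h.d_le hv hm.le) (hv.le m hm) (hv.lt_large hm) hx
      h.c_lt_d (by omega) (by simpa using hdes) (by simpa using hdes')

end Step

/-- The explicit form of the condition that the recording tableau of `v 0, …, v (m - 1)` is `T_k`:
the word consists of two decreasing runs, the first of length `k`, with entrywise inequalities
between the ends of the runs if the first is the longer one, and between their beginnings
otherwise. -/
structure IsTwoRun (v : ℕ → ℕ) (m k : ℕ) : Prop where
  first : ∀ i, i + 1 < k → v (i + 1) < v i
  second : ∀ i, k ≤ i → i + 1 < m → v (i + 1) < v i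
  short : m - k ≤ k → ∀ i < m - k, v (k - 1 - i) < v (m - 1 - i)
  long : k ≤ m - k → ∀ i < k, v i < v (k + i)

/-- Up to the letter number `m`, no large entry has moved up, and the recording tableau is `T_k`. -/
structure IsTwoRunState (f N : ℕ) (v : ℕ → ℕ) (m k l₁ l₂ : ℕ) (c d : ℕ → ℕ) : Prop
    extends IsState f N v m l₁ l₂ c d where
  one_le : 1 ≤ k
  k_le : k ≤ m
  run : IsTwoRun v m k
  asc : k < m → v (k - 1) < v k
  rows : ∀ t < m, newRow v t = twoColumnRow k t
  short : m - k ≤ k → l₂ = m - k ∧ l₁ = k ∧ (∀ i < k, c i = v (k - 1 - i)) ∧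
    ∀ i < m - k, d i = v (m - 1 - i)
  long : k ≤ m - k → l₂ = k ∧ l₁ = m - k ∧ v (m - 1) ≤ d 0
  -- Either alternative prevents the insertion of a letter below `v (m - 1)` from staying in the
  -- second column. For a letter above `v (m - 1)` but below `d 0`, the first forces it to stay
  -- there, and the second leaves no room for such a letter.
  strict : k < m - k → (v (m - 1) = c 0 ∧ ∀ i < l₂, c (i + 1) < d i) ∨
    (v (m - 1) = d 0 ∧ ∃ p, 1 ≤ p ∧ p ≤ l₂ ∧ d (p - 1) < c p)

/-- The letter number `m` destroys all three properties that are to be shown equivalent. -/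
structure IsFailure (f N : ℕ) (v : ℕ → ℕ) (m k : ℕ) : Prop where
  one_le : 1 ≤ k
  k_lt : k < m
  asc : v (k - 1) < v k
  run : IsTwoRun v m k
  rows : ∀ t < m, newRow v t = twoColumnRow k t
  moved : HasMovedUp f N v (m + 1)
  newRow_ne : newRow v m ≠ m - k
  not_run : ¬ IsTwoRun v (m + 1) k

/-! ### The induction: two-run states and failures -/

section

variable {f N n m k l₁ l₂ : ℕ} {v c d : ℕ → ℕ}

theorem rows_succ (hm : k ≤ m) (h : ∀ t < m, newRow v t = twoColumnRow k t)
    (hr : newRow v m = m - k) : ∀ t < m + 1, newRow v t = twoColumnRow k t := by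
  intro t ht
  rcases Nat.lt_succ_iff_lt_or_eq.mp ht with h' | rfl
  · exact h t h'
  · rw [hr, twoColumnRow, if_neg (by omega)]

/-- Either there is a first `p` where the insertion path meets the first column, or the path stays
in the second column. -/
theorem exists_first_or_forall {D : ℕ → ℕ} (hne : ∀ i < l₁, ∀ j ≤ l₂, c i ≠ D j) :
    (∃ p ≤ l₂, (p < l₁ → D p < c p) ∧ ∀ i < p, c i < D i) ∨
      (l₂ < l₁ ∧ ∀ i ≤ l₂, c i < D i) := by
  by_cases h : ∃ p, p ≤ l₂ ∧ (p < l₁ → D p < c p)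
  · left
    classical
    refine ⟨Nat.find h, (Nat.find_spec h).1, (Nat.find_spec h).2, fun i hi => ?_⟩
    have h1 := Nat.find_min h hi
    have h2 := (Nat.find_spec h).1
    have h3 := hne i
    push Not at h1
    obtain ⟨h4, h5⟩ := h1 (by omega)
    exact lt_of_le_of_ne h5 (hne i h4 i (by omega))
  · right
    push Not at h
    exact ⟨(h l₂ le_rfl).1, fun i hi => lt_of_le_of_ne (h i hi).2 (hne i (h i hi).1 i hi)⟩

/-- The prefix is decreasing and fills a single column, so no letter fails: an ascent opens the
second run, a descent prolongs the first. -/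
theorem IsTwoRunState.step_self (h : IsTwoRunState f N v m m l₁ l₂ c d) (hv : IsWord v n N)
    (hm : m < n) (hf : m + 2 ≤ f) :
    ∃ k' l₁' l₂' c' d', IsTwoRunState f N v (m + 1) k' l₁' l₂' c' d' := by
  have hm1 := h.one_le
  obtain ⟨rfl, rfl, hc⟩ : l₂ = 0 ∧ l₁ = m ∧ ∀ i < m, c i = v (m - 1 - i) := by
    simpa using h.short (by omega)
  have hc0 : c 0 = v (l₁ - 1) := hc 0 hm1
  have hne : v (l₁ - 1) ≠ v l₁ := fun e => by
    have := hv.inj _ (by omega) _ hm e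
    omega
  rcases Nat.lt_or_gt_of_ne hne with hlt | hlt
  · obtain ⟨hs, hr⟩ := h.toIsState.of_forall_lt hv hm hm1 hf (by simp) hm1
      (by intro i hi; obtain rfl : i = 0 := by omega
          rw [hc0]; exact hlt) (by simp)
    refine ⟨l₁, _, _, _, _, hs, hm1, by omega, ⟨h.run.first, ?_, ?_, ?_⟩, fun _ => hlt,
      rows_succ le_rfl h.rows (by omega), ?_, ?_, ?_⟩
    · intro i hi hi'; omega
    · intro _ i hi
      obtain rfl : i = 0 := by omega
      simpa using hlt
    · intro h' i hi
      obtain rfl : l₁ = 1 := by omega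
      obtain rfl : i = 0 := by omega
      simpa using hlt
    · intro _
      refine ⟨by omega, rfl, hc, fun i hi => ?_⟩
      obtain rfl : i = 0 := by omega
      rfl
    · intro _
      refine ⟨by omega, by omega, ?_⟩
      simp [consSeq]
    · intro _; omega
  · obtain ⟨hs, hr⟩ := h.toIsState.of_lt (p := 0) hv hm hm1 hf (by simp) (by simp)
      (by intro _; rw [hc0]; exact hlt) (by simp)
      (by intro _
          have := hlt
          simpa using this)
    refine ⟨l₁ + 1, _, _, _, _, hs, by omega, le_rfl, ⟨?_, ?_, ?_, ?_⟩, by omega, ?_, ?_, ?_, ?_⟩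
    · intro i hi
      rcases Nat.lt_or_ge (i + 1) l₁ with h' | h'
      · exact h.run.first i h'
      · obtain rfl : i = l₁ - 1 := by omega
        rwa [show l₁ - 1 + 1 = l₁ by omega]
    · intro i hi hi'; omega
    · intro _ i hi; omega
    · intro h'; omega
    · intro t ht
      rw [twoColumnRow, if_pos ht]
      rcases Nat.lt_succ_iff_lt_or_eq.mp ht with h' | rfl
      · rw [h.rows t h', twoColumnRow, if_pos h']
      · exact hr
    · intro _
      refine ⟨by omega, rfl, fun i hi => ?_, fun i hi => by omega⟩
      rcases i with _ | i
      · simp [consSeq]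
      · simp only [Nat.not_lt_zero, if_false, Nat.succ_ne_zero]
        rw [show i + 1 - 1 = i by omega, hc i (by omega)]
        congr 1
        omega
    · intro _; omega
    · intro _; omega

/-- Hence a letter that prolongs the second run is below `d 0`, as the comparison of slides with
insertion requires. -/
theorem IsTwoRunState.last_le (h : IsTwoRunState f N v m k l₁ l₂ c d) (hk : k < m) :
    v (m - 1) ≤ d 0 := by
  rcases Nat.lt_or_ge (m - k) k with h' | h'
  · obtain ⟨-, -, -, hd⟩ := h.short h'.le
    rw [hd 0 (by omega)]
    simp
  · exact (h.long h').2.2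

theorem IsTwoRunState.pos_right (h : IsTwoRunState f N v m k l₁ l₂ c d) (hk : k < m) :
    0 < l₂ := by
  have := h.one_le
  rcases Nat.lt_or_ge (m - k) k with h' | h'
  · have := (h.short h'.le).1
    omega
  · have := (h.long h').1
    omega

/-- A second ascent is a failure. -/
theorem IsTwoRunState.isFailure_of_gt (h : IsTwoRunState f N v m k l₁ l₂ c d) (hv : IsWord v n N)
    (hm : m < n) (hf : m + 2 ≤ f) (hk : k < m) (hx : v (m - 1) < v m) : IsFailure f N v m k := by
  have hk1 := h.one_le
  have h2 := h.pos_right hk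
  have hlast := h.last_le hk
  have hsize := h.size
  have hle := h.le
  have hasc := h.asc hk
  have hnr : ¬ IsTwoRun v (m + 1) k := by
    intro h'
    have := h'.second (m - 1) (by omega) (by omega)
    rw [show m - 1 + 1 = m by omega] at this
    omega
  suffices hs : HasMovedUp f N v (m + 1) ∧ newRow v m ≠ m - k from
    ⟨hk1, hk, hasc, h.run, h.rows, hs.1, hs.2, hnr⟩
  have hne : d 0 ≠ v m := by
    obtain ⟨t, ht, e⟩ := h.d_mem 0 h2
    rw [e]
    intro e'
    have := hv.inj t (by omega) m hm e'
    omega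
  rcases Nat.lt_or_gt_of_ne hne with hd | hd
  · refine ⟨h.hasMovedUp_of_gt hv hm hf h2 hd ?_, ?_⟩
    -- The ascent from `v (k - 1)` to `v k` puts the smaller large entry in row `m - k + 1`, just
    -- below the larger one. A hole ends in row `m - k` in either case, as `m - k` is `l₂` if the
    -- second run is the shorter one and `l₁` otherwise.
    · rcases Nat.lt_or_ge (m - k) k with h' | h'
      · obtain ⟨e2, e1, -, -⟩ := h.short h'.le
        left
        rw [show m - 1 - l₂ = k - 1 by omega, show m - l₂ = k by omega]
        exact ⟨by omega, hasc⟩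
      · obtain ⟨e2, e1, -⟩ := h.long h'
        right
        rw [show m - 1 - l₁ = k - 1 by omega, show m - l₁ = k by omega]
        refine ⟨fun h'' => ?_, hasc⟩
        have := h.run.second (m - 1 - l₂) (by omega) (by omega)
        rwa [show m - 1 - l₂ + 1 = m - l₂ by omega] at this
    · have := rowInsert_colRows_of_gt (l₁ := l₁) (x := v m) (by omega) h2 (h.c_lt_d 0 h2) hd
      rw [newRow, h.ins, this]
      omega
  · refine ⟨h.hasMovedUp_of_between hv hm hf h2 hd hx, ?_⟩
    have h' : k < m - k := by
      by_contra h'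
      have := (h.short (by omega)).2.2.2 0 (by omega)
      simp only [Nat.sub_zero] at this
      omega
    obtain ⟨e2, e1, -⟩ := h.long h'.le
    rcases h.strict h' with ⟨hc0, hcd⟩ | ⟨hd0, -⟩
    -- The path stays in the second column, so the new cell is in row `l₂ = k`, which differs from
    -- `m - k`.
    · have := rowInsert_colRows_of_forall_lt (l₁ := l₁) (l₂ := l₂) (c := c)
        (D := consSeq (v m) d) (by omega) ?_ fun i hi =>
          consSeq_lt h.toIsColumnPair (fun _ => hd) i (i + 1) (by omega) (by omega)
      · have e : newRow v m = l₂ := by rw [newRow, h.ins]; exact congrArg Prod.snd this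
        omega
      · intro i hi
        cases i with
        | zero => rw [← hc0]; exact hx
        | succ i => exact hcd i (by omega)
    · omega

/-- Both columns are known explicitly as reversed runs, so "the path stays in the second column" is
literally the inequality between the ends of the runs. If it fails, the hole ends in row `m - k`, at
the ascent. -/
theorem IsTwoRunState.step_of_lt_short (h : IsTwoRunState f N v m k l₁ l₂ c d) (hv : IsWord v n N)
    (hm : m < n) (hf : m + 2 ≤ f) (hk : k < m) (hx : v m < v (m - 1)) (h' : m - k < k) :
    (∃ k' l₁' l₂' c' d', IsTwoRunState f N v (m + 1) k' l₁' l₂' c' d') ∨ IsFailure f N v m k := by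
  have hk1 := h.one_le
  have hlast := h.last_le hk
  have hsize := h.size
  have hasc := h.asc hk
  have hx' : 0 < l₂ → v m < d 0 ∧ v m < v (m - 1) := fun _ => ⟨by omega, hx⟩
  obtain ⟨e2, e1, hc, hd⟩ := h.short h'.le
  have hD : ∀ i ≤ m - k, consSeq (v m) d i = v (m - i) := by
    intro i hi
    cases i with
    | zero => rfl
    | succ i =>
      rw [consSeq, hd i (by omega)]
      congr 1
      omega
  rcases exists_first_or_forall (ne_consSeq h.toIsColumnPair hv hm) with
    ⟨p, hp2, hp, hcD⟩ | ⟨h21, hcD⟩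
  · right
    refine ⟨hk1, hk, hasc, h.run, h.rows, ?_, ?_, ?_⟩
    · apply h.hasMovedUp_of_lt hv hm (by omega) hf hx' hp2 hp hcD (by omega)
      rw [show m - 1 - l₂ = k - 1 by omega, show m - l₂ = k by omega]
      exact hasc
    · rw [h.newRow_of_lt (fun _ => (hx' (by omega)).1) hp2 hp hcD]
      omega
    · intro hr
      have h1 := hr.short (by omega) p (by omega)
      have h2 := hp (by omega)
      rw [hc p (by omega), hD p (by omega)] at h2
      rw [show m + 1 - 1 - p = m - p by omega] at h1
      omega
  · left
    obtain ⟨hs, hr⟩ := h.toIsState.of_forall_lt hv hm (by omega) hf hx' h21 hcD (by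
      intro _
      have := h.run.first (m - 1 - l₁) (by omega)
      rwa [show m - 1 - l₁ + 1 = m - l₁ by omega] at this)
    have hrs : ∀ i < m + 1 - k, v (k - 1 - i) < v (m - i) := by
      intro i hi
      have := hcD i (by omega)
      rwa [hc i (by omega), hD i (by omega)] at this
    refine ⟨k, _, _, _, _, hs, hk1, by omega, ⟨h.run.first, ?_, ?_, ?_⟩, fun _ => hasc,
      rows_succ hk.le h.rows (by omega), ?_, ?_, ?_⟩
    · intro i hi hi'
      rcases Nat.lt_or_ge (i + 1) m with h3 | h3
      · exact h.run.second i hi h3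
      · obtain rfl : i = m - 1 := by omega
        rwa [show m - 1 + 1 = m by omega]
    · intro _ i hi
      exact hrs i hi
    -- Now `m + 1 = 2k`: the runs are equally long, and comparing ends or beginnings differs only by
    -- `i ↦ k - 1 - i`.
    · intro h3 i hi
      have := hrs (k - 1 - i) (by omega)
      rwa [show k - 1 - (k - 1 - i) = i by omega, show m - (k - 1 - i) = k + i by omega] at this
    · intro _
      refine ⟨by omega, e1, hc, fun i hi => ?_⟩
      rw [hD i (by omega)]
      simp
    · intro h3
      exact ⟨by omega, by omega, le_rfl⟩
    · intro h3; omega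

/-- Once the second run is at least as long as the first, a further descent imposes no new
inequality: by `strict` its insertion always ends in the first column. -/
theorem IsTwoRunState.step_of_lt_long (h : IsTwoRunState f N v m k l₁ l₂ c d) (hv : IsWord v n N)
    (hm : m < n) (hf : m + 2 ≤ f) (hk : k < m) (hx : v m < v (m - 1)) (h' : k ≤ m - k) :
    ∃ k' l₁' l₂' c' d', IsTwoRunState f N v (m + 1) k' l₁' l₂' c' d' := by
  have hk1 := h.one_le
  have hsize := h.size
  have hasc := h.asc hk
  obtain ⟨e2, e1, hlast⟩ := h.long h'
  have hx' : 0 < l₂ → v m < d 0 ∧ v m < v (m - 1) := fun _ => ⟨by omega, hx⟩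
  have hlt := consSeq_lt h.toIsColumnPair fun h0 => (hx' h0).1
  rcases exists_first_or_forall (ne_consSeq h.toIsColumnPair hv hm) with
    ⟨p, hp2, hp, hcD⟩ | ⟨h21, hcD⟩
  · obtain ⟨hs, hr⟩ := h.toIsState.of_lt hv hm (by omega) hf hx' hp2 hp hcD (by
      intro _
      have := h.run.second (m - 1 - l₂) (by omega) (by omega)
      rwa [show m - 1 - l₂ + 1 = m - l₂ by omega] at this)
    refine ⟨k, _, _, _, _, hs, hk1, by omega, ⟨h.run.first, ?_, ?_, ?_⟩, fun _ => hasc,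
      rows_succ hk.le h.rows (by omega), ?_, ?_, ?_⟩
    · intro i hi hi'
      rcases Nat.lt_or_ge (i + 1) m with h3 | h3
      · exact h.run.second i hi h3
      · obtain rfl : i = m - 1 := by omega
        rwa [show m - 1 + 1 = m by omega]
    · intro h3; omega
    · intro _ i hi
      exact h.run.long h' i hi
    · intro h3; omega
    · intro _
      refine ⟨e2, by omega, ?_⟩
      rw [show m + 1 - 1 = m by omega]
      split_ifs
      · exact le_rfl
      · exact (hlt 0 1 (by omega) (by omega)).le
    · intro _
      rw [show m + 1 - 1 = m by omega]
      -- If `p = 0`, the new letter tops the first column and the old entry `c i` moves next to `d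
      -- (i + 1)`. Otherwise it tops the second, and `p` itself is the required witness.
      rcases Nat.eq_zero_or_pos p with rfl | hp0
      · left
        exact ⟨by simp [consSeq], fun i hi => h.c_lt_d i hi⟩
      · right
        refine ⟨by simp [consSeq, hp0], p, hp0, hp2, ?_⟩
        rw [if_pos (by omega), if_neg (by omega), if_pos rfl]
        exact hlt (p - 1) p (by omega) hp2
  · exfalso
    rcases h.strict (by omega) with ⟨hc0, -⟩ | ⟨-, p, hp1, hp2, hp⟩
    · have := hcD 0 (by omega)
      simp only [consSeq] at this
      omega
    · have := hcD p hp2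
      obtain ⟨q, rfl⟩ : ∃ q, p = q + 1 := ⟨p - 1, by omega⟩
      simp only [consSeq, Nat.add_sub_cancel] at this hp
      omega

theorem IsTwoRunState.step (h : IsTwoRunState f N v m k l₁ l₂ c d) (hv : IsWord v n N)
    (hm : m < n) (hf : m + 2 ≤ f) :
    (∃ k' l₁' l₂' c' d', IsTwoRunState f N v (m + 1) k' l₁' l₂' c' d') ∨ IsFailure f N v m k := by
  have := h.one_le
  rcases h.k_le.eq_or_lt with rfl | hk
  · exact Or.inl (h.step_self hv hm hf)
  · have hne : v (m - 1) ≠ v m := fun e => by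
      have := hv.inj _ (by omega) _ hm e
      omega
    rcases Nat.lt_or_gt_of_ne hne with hx | hx
    · exact Or.inr (h.isFailure_of_gt hv hm hf hk hx)
    · rcases Nat.lt_or_ge (m - k) k with h' | h'
      · exact h.step_of_lt_short hv hm hf hk hx h'
      · exact Or.inl (h.step_of_lt_long hv hm hf hk hx h')

theorem isTwoRunState_one (f N : ℕ) (v : ℕ → ℕ) :
    IsTwoRunState f N v 1 1 1 0 (fun _ => v 0) fun _ => 0 := by
  refine ⟨⟨⟨by omega, by omega, ?_, ?_, ?_, ?_, ?_, ?_⟩, ?_, ?_⟩, le_rfl, le_rfl, ⟨?_, ?_, ?_, ?_⟩,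
    ?_, ?_, ?_, ?_, ?_⟩
  · intro i j; omega
  · intro i j; omega
  · intro i hi; omega
  · intro i _; exact ⟨0, by omega, rfl⟩
  · intro i hi; omega
  · intro i _ j hj; omega
  · rw [stackTwo, rectFuel_cons]
    funext i j
    simp only [List.range_zero, List.reverse_nil, List.foldl_nil, tab]
    rcases i with _ | i
    · rcases j with _ | _ | j <;> simp [consRow, skewRow]
    · simp [consRow, stackTwo, rectFuel, SkewRows.innerCells, SkewRows.toFilling]
  · simp [prefixWord, rsk, rowInsert, colRows]
  · intro i hi; omega
  · intro i hi hi'; omega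
  · intro _ i hi; omega
  · intro h'; omega
  · intro h'; omega
  · intro t ht
    obtain rfl : t = 0 := by omega
    simp [newRow, prefixWord, rsk, rowInsert, twoColumnRow]
  · intro _
    refine ⟨rfl, rfl, fun i hi => ?_, fun i hi => by omega⟩
    obtain rfl : i = 0 := by omega
    rfl
  · intro h'; omega
  · intro h'; omega

theorem exists_state_or_failure (hv : IsWord v n N) (hf : n + 1 ≤ f) (hm : 1 ≤ m) (hmn : m ≤ n) :
    (∃ k l₁ l₂ c d, IsTwoRunState f N v m k l₁ l₂ c d) ∨ ∃ m' < m, ∃ k, IsFailure f N v m' k := by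
  induction m with
  | zero => omega
  | succ m ih =>
    rcases Nat.eq_zero_or_pos m with rfl | hm0
    · exact Or.inl ⟨1, 1, 0, _, _, isTwoRunState_one f N v⟩
    · rcases ih hm0 (by omega) with ⟨k, l₁, l₂, c, d, h⟩ | ⟨m', hm', k, h⟩
      · rcases h.step hv (by omega) (by omega) with h' | h'
        · exact Or.inl h'
        · exact Or.inr ⟨m, by omega, k, h'⟩
      · exact Or.inr ⟨m', by omega, k, h⟩

theorem HasMovedUp.mono (h : HasMovedUp f N v m) (hmn : m ≤ n) : HasMovedUp f N v n := by
  induction n, hmn using Nat.le_induction with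
  | base => exact h
  | succ n _ ih => exact ih.succ

/-- The letter number `k`, counted from `0`, puts its new cell in row `0`; this forces `k' = k`, and
the row of letter `m` then contradicts `newRow_ne`. -/
theorem IsFailure.rows_ne (h : IsFailure f N v m k) {k' : ℕ} (hmn : m < n) :
    ¬ ∀ t < n, newRow v t = twoColumnRow k' t := by
  intro h'
  have h1 := h.one_le
  have h2 := h.k_lt
  have e1 := h' k (by omega)
  rw [h.rows k h2] at e1
  have e2 := h' m hmn
  have e3 := h.newRow_ne
  have e4 : k' < k → newRow v k' = k' := fun e => by
    rw [h.rows k' (by omega), twoColumnRow, if_pos e]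
  have e5 := h' k'
  simp only [twoColumnRow] at e1 e2 e5
  grind

/-- Deleting the last letter moves each comparison at the ends of the runs one step back in the
second run, to a larger letter. -/
theorem IsTwoRun.mono (h : IsTwoRun v n k) (hk : 1 ≤ k) (hkm : k ≤ m) (hmn : m ≤ n) :
    IsTwoRun v m k := by
  induction n, hmn using Nat.le_induction with
  | base => exact h
  | succ n hn ih =>
    apply ih
    refine ⟨h.first, fun i hi hi' => h.second i hi (by omega), fun h' i hi => ?_, fun h' i hi => ?_⟩
    · have h2 := h.second (n - 1 - i) (by omega) (by omega)
      rcases Nat.lt_or_ge k (n + 1 - k) with h3 | h3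
      · have := h.long h3.le (k - 1 - i) (by omega)
        rwa [show k + (k - 1 - i) = n - 1 - i by omega] at this
      · have := h.short h3 i (by omega)
        rw [show n + 1 - 1 - i = n - 1 - i + 1 by omega] at this
        omega
    · exact h.long (by omega) i hi

/-- The ascent at `k` can only be the border between the two runs, so `k' = k`, and the prefix of
length `m + 1` is already wrong. -/
theorem IsFailure.not_isTwoRun (h : IsFailure f N v m k) {k' : ℕ} (hk' : 1 ≤ k') (hmn : m < n) :
    ¬ IsTwoRun v n k' := by
  intro h'
  have h1 := h.one_le
  have h2 := h.k_lt
  have h3 := h.asc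
  have e : k' = k := by
    by_contra hne
    have e : v k < v (k - 1) := by
      rcases Nat.lt_or_gt_of_ne hne with h4 | h4
      · have := h'.second (k - 1) (by omega) (by omega)
        rwa [show k - 1 + 1 = k by omega] at this
      · have := h'.first (k - 1) (by omega)
        rwa [show k - 1 + 1 = k by omega] at this
    omega
  subst e
  exact h.not_run (h'.mono hk' (by omega) hmn)

end

/-! ### From the dichotomy to stabilization and recording tableaux -/

section

variable {f N n m k : ℕ} {v : ℕ → ℕ}

theorem IsTwoRunState.run_iff_rows {k₀ l₁ l₂ : ℕ} {c d : ℕ → ℕ}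
    (h : IsTwoRunState f N v n k₀ l₁ l₂ c d) (hk : 1 ≤ k) (hkn : k ≤ n) :
    IsTwoRun v n k ↔ ∀ t < n, newRow v t = twoColumnRow k t := by
  have h1 := h.one_le
  have h2 := h.k_le
  rcases eq_or_ne k k₀ with rfl | hne
  · exact ⟨fun _ => h.rows, fun _ => h.run⟩
  · refine ⟨fun hr => absurd hr ?_, fun hr => absurd hr ?_⟩
    · intro hr
      rcases h2.eq_or_lt with rfl | h3
      · have hdec : ∀ i j, i < j → j < k₀ → v j < v i := by
          intro i j hij
          induction j, hij using Nat.le_induction with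
          | base => exact h.run.first i
          | succ j hj ih => exact fun h' => (h.run.first j h').trans (ih (by omega))
        rcases Nat.lt_or_ge k (k₀ - k) with h4 | h4
        · have := hr.long h4.le 0 hk
          have := hdec 0 k hk (by omega)
          simp only [Nat.add_zero] at *
          omega
        · have := hr.short h4 0 (by omega)
          have := hdec (k - 1) (k₀ - 1) (by omega) (by omega)
          simp only [Nat.sub_zero] at *
          omega
      · have h3' := h.asc h3
        have h5 : v k₀ < v (k₀ - 1) := by
          rcases Nat.lt_or_gt_of_ne hne with h4 | h4
          · have := hr.second (k₀ - 1) (by omega) (by omega)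
            rwa [show k₀ - 1 + 1 = k₀ by omega] at this
          · have := hr.first (k₀ - 1) (by omega)
            rwa [show k₀ - 1 + 1 = k₀ by omega] at this
        omega
    · intro hr
      have e1 := hr k
      have e2 := hr k₀
      have e3 := h.rows k
      have e4 := h.rows k₀
      simp only [twoColumnRow] at e1 e2 e3 e4
      grind

theorem run_iff_rows (hv : IsWord v n N) (hk : 1 ≤ k) (hkn : k ≤ n) :
    IsTwoRun v n k ↔ ∀ t < n, newRow v t = twoColumnRow k t := by
  -- Rectification is only auxiliary here; any bound of at least `n + 1` would serve.
  rcases exists_state_or_failure (f := n + 1) hv le_rfl (hk.trans hkn) le_rfl with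
    ⟨k', l₁, l₂, c, d, h⟩ | ⟨m, hm, k', h⟩
  · exact h.run_iff_rows hk hkn
  · exact ⟨fun h' => absurd h' (h.not_isTwoRun hk hm), fun h' => absurd h' (h.rows_ne hm)⟩

/-! ### Stabilization at two -/

theorem stackTwo_toFilling (N : ℕ) (v : ℕ → ℕ) (m i j : ℕ) : (stackTwo N v m).toFilling i j =
    if i < m then if j = m - 1 - i then some (v (m - 1 - i))
      else if j = m - i then some (v (m - 1 - i) + N) else none else none := by
  induction m generalizing i with
  | zero => simp [stackTwo, SkewRows.toFilling]
  | succ m ih =>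
    rw [stackTwo, toFilling_cons]
    cases i with
    | zero =>
      simp only [consRow, skewRow]
      rcases Nat.lt_or_ge j m with h | h
      · grind
      · obtain ⟨t, rfl⟩ := Nat.exists_eq_add_of_le h
        rcases t with _ | _ | t <;> simp
    | succ i =>
      simp only [consRow, ih]
      grind

theorem inRow_stackTwo {x i : ℕ} : (stackTwo N v m).toFilling.InRow x i ↔
    i < m ∧ (x = v (m - 1 - i) ∨ x = v (m - 1 - i) + N) := by
  constructor
  · rintro ⟨j, hj⟩
    rw [stackTwo_toFilling] at hj
    grind
  · rintro ⟨h1, h2 | h2⟩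
    · exact ⟨m - 1 - i, by rw [stackTwo_toFilling, if_pos h1, if_pos rfl, h2]⟩
    · exact ⟨m - i, by
        rw [stackTwo_toFilling, if_pos h1, if_neg (by omega), if_pos rfl, h2]⟩

theorem inRow_tab {l₁ l₂ x i : ℕ} {c d B : ℕ → ℕ} (hc : ∀ i < l₁, c i < x)
    (hd : ∀ i < l₂, d i < x) (h21 : l₂ ≤ l₁) (h1 : l₁ ≤ m) :
    (tab l₁ l₂ m c d B).InRow x i ↔ i < m ∧ x = B i := by
  constructor
  · rintro ⟨j, hj⟩
    have := hc i
    have := hd i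
    simp only [tab] at hj
    grind
  · rintro ⟨hi, rfl⟩
    refine ⟨if i < l₂ then 2 else if i < l₁ then 1 else 0, ?_⟩
    simp only [tab]
    grind

/-- In a state the large entries end their original rows; after a failure one of them is strictly
above its row. -/
theorem stable_two_iff (hn : 1 ≤ n) (hv : IsWord v n n) (hf : n + 1 ≤ f) :
    (∀ x ∈ Finset.Icc (n + 1) (2 * n), ∀ i, (rectFuel f (stackTwo n v n)).InRow x i ↔
      (stackTwo n v n).toFilling.InRow x i) ↔ ∃ k, 1 ≤ k ∧ k ≤ n ∧ IsTwoRun v n k := by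
  rcases exists_state_or_failure hv hf hn le_rfl with ⟨k, l₁, l₂, c, d, h⟩ | ⟨m, hm, k, h⟩
  · refine ⟨fun _ => ⟨k, h.one_le, h.k_le, h.run⟩, fun _ x hx i => ?_⟩
    rw [Finset.mem_Icc] at hx
    have hsize := h.size
    rw [h.rect, inRow_stackTwo, inRow_tab _ _ h.le (by omega)]
    · constructor
      · exact fun h' => ⟨h'.1, Or.inr h'.2⟩
      · rintro ⟨h1, h2⟩
        have := hv.le (n - 1 - i) (by omega)
        exact ⟨h1, by omega⟩
    · intro i hi
      have := h.c_le hv le_rfl i hi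
      omega
    · intro i hi
      have := h.d_le hv le_rfl i hi
      omega
  · refine ⟨fun h' => ?_, fun ⟨k', h1, _, h2⟩ => absurd h2 (h.not_isTwoRun h1 hm)⟩
    obtain ⟨t, ht, ha⟩ := h.moved.mono hm
    have := hv.pos t ht
    have := hv.le t ht
    obtain ⟨j, hj⟩ := (h' (v t + n) (by rw [Finset.mem_Icc]; omega) (n - 1 - t)).mpr
      (inRow_stackTwo.mpr ⟨by omega, Or.inr (by rw [show n - 1 - (n - 1 - t) = t by omega])⟩)
    exact absurd (ha _ _ hj) (lt_irrefl _)

/-! ### Stabilization at one -/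

/-- The rows of `T(w)` that belong to the first `m` letters. -/
def stackOne (v : ℕ → ℕ) : ℕ → SkewRows
  | 0 => []
  | m + 1 => (m, [v m]) :: stackOne v m

theorem stackOne_toFilling (v : ℕ → ℕ) (m i j : ℕ) : (stackOne v m).toFilling i j =
    if i < m ∧ j = m - 1 - i then some (v (m - 1 - i)) else none := by
  induction m generalizing i with
  | zero => simp [stackOne, SkewRows.toFilling]
  | succ m ih =>
    rw [stackOne, toFilling_cons]
    cases i with
    | zero =>
      simp only [consRow, skewRow]
      rcases Nat.lt_or_ge j m with h | h
      · grind
      · obtain ⟨t, rfl⟩ := Nat.exists_eq_add_of_le h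
        rcases t with _ | t <;> simp
    | succ i =>
      simp only [consRow, ih]
      grind

theorem inRow_stackOne {x i : ℕ} :
    (stackOne v m).toFilling.InRow x i ↔ i < m ∧ x = v (m - 1 - i) := by
  constructor
  · rintro ⟨j, hj⟩
    rw [stackOne_toFilling] at hj
    grind
  · rintro ⟨h1, h2⟩
    exact ⟨m - 1 - i, by rw [stackOne_toFilling, if_pos ⟨h1, rfl⟩, h2]⟩

theorem slide_consRow_singleton {x j : ℕ} {G : Filling} (hf : 1 ≤ f)
    (h0 : ∀ b, G 0 j = some b → x < b) (h1 : G 0 (j + 1) = none) :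
    slide f 0 j (consRow (skewRow (j + 1) [x]) G) = consRow (skewRow j [x]) G := by
  obtain ⟨g, rfl⟩ : ∃ g, f = g + 1 := ⟨f - 1, by omega⟩
  rw [slide_right (a := x), slide_stop]
  · funext i k
    cases i with
    | zero =>
      simp only [Filling.set, consRow, skewRow]
      rcases Nat.lt_or_ge k j with h | h
      · grind
      · obtain ⟨t, rfl⟩ := Nat.exists_eq_add_of_le h
        rcases t with _ | _ | t
        · grind
        · grind
        · grind
    | succ i => simp [Filling.set, consRow]
  · simpa [Filling.set, consRow] using h1
  · simp only [Filling.set, consRow, skewRow]; grind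
  · simp [consRow, skewRow]
  · simpa [consRow] using h0

theorem foldl_slide_consRow_singleton {x : ℕ} {G : Filling} (r : ℕ) (hf : 1 ≤ f)
    (h1 : ∀ j, 1 ≤ j → G 0 j = none) :
    (List.range (1 + r)).reverse.foldl (fun F j => slide f 0 j F)
        (consRow (skewRow (1 + r) [x]) G) = slide f 0 0 (consRow (skewRow 1 [x]) G) := by
  induction r with
  | zero => rfl
  | succ r ih =>
    rw [← Nat.add_assoc, List.range_succ, List.reverse_append, List.reverse_singleton,
      List.singleton_append, List.foldl_cons, slide_consRow_singleton hf, ih]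
    · intro b hb; rw [h1 _ (by omega)] at hb; simp at hb
    · exact h1 _ (by omega)

/-- A decreasing word piles up in one column. At the first ascent, the slide into `(0, 0)` lifts the
smaller letter out of its row for good. -/
theorem rectFuel_stackOne (hf : 1 ≤ f) (hv : IsWord v n N) (hmn : m ≤ n) :
    ((∀ i, i + 1 < m → v (i + 1) < v i) →
      rectFuel f (stackOne v m) = fun i j => if i < m ∧ j = 0 then some (v (m - 1 - i)) else none) ∧
    (¬ (∀ i, i + 1 < m → v (i + 1) < v i) →
      ∃ t < m, Above (v t) (m - 1 - t) (rectFuel f (stackOne v m))) := by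
  induction m with
  | zero =>
    refine ⟨fun _ => ?_, fun h => absurd (fun i hi => by omega) h⟩
    funext i j
    simp [stackOne, rectFuel, SkewRows.innerCells, SkewRows.toFilling]
  | succ m ih =>
    specialize ih (by omega)
    rw [stackOne, rectFuel_cons]
    by_cases hd : ∀ i, i + 1 < m → v (i + 1) < v i
    · rw [ih.1 hd]
      rcases Nat.eq_zero_or_pos m with rfl | hm
      · refine ⟨fun _ => ?_, fun h => absurd (fun i hi => by omega) h⟩
        funext i j
        rcases i with _ | i
        · rcases j with _ | j <;> simp [consRow, skewRow]
        · simp [consRow]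
      · obtain ⟨r, rfl⟩ : ∃ r, m = 1 + r := ⟨m - 1, by omega⟩
        rw [foldl_slide_consRow_singleton r hf (by intro j hj; simp; omega)]
        constructor
        · intro hd'
          have h1 := hd' r (by omega)
          rw [slide_consRow_singleton hf]
          · funext i j
            rcases i with _ | i
            · rcases j with _ | j <;> simp [consRow, skewRow]
            · simp only [consRow]
              rw [show 1 + r - 1 - i = 1 + r + 1 - 1 - (i + 1) by omega]
              exact if_congr (by omega) rfl rfl
          · intro b hb
            simp at hb
            rw [Nat.add_comm 1 r]
            omega
          · simp
        · intro hd'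
          have hlt : v r < v (r + 1) := by
            have hne : v r ≠ v (r + 1) := fun e => by
              have := hv.inj r (by omega) (r + 1) (by omega) e
              omega
            by_contra hlt
            apply hd'
            intro i hi
            rcases Nat.lt_or_ge (i + 1) (1 + r) with h3 | h3
            · exact hd i h3
            · obtain rfl : i = r := by omega
              omega
          obtain ⟨g, rfl⟩ : ∃ g, f = g + 1 := ⟨f - 1, by omega⟩
          refine ⟨r, by omega, ?_⟩
          rw [slide_down (b := v r)]
          · apply Above.slide
            intro i j hij
            have h4 := hv.inj r (by omega) (r + 1) (by omega)
            rcases i with _ | i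
            · omega
            · have h5 := hv.inj r (by omega) (1 + r - 1 - i) (by omega)
              simp only [Filling.set, consRow] at hij
              grind
          · simp [consRow]
          · intro a ha
            simp [consRow, skewRow] at ha
            rw [← ha, Nat.add_comm]
            exact hlt
    · refine ⟨fun h => absurd (fun i hi => h i (by omega)) hd, fun _ => ?_⟩
      obtain ⟨t, ht, h⟩ := ih.2 hd
      refine ⟨t, by omega, ?_⟩
      apply Above.foldl_slide
      intro i j hij
      cases i with
      | zero => omega
      | succ i =>
        have := h i j hij
        omega

theorem stable_one_iff (hv : IsWord v n n) (hf : 1 ≤ f) :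
    (∀ x ∈ Finset.Icc 1 n, ∀ i, (rectFuel f (stackOne v n)).InRow x i ↔
      (stackOne v n).toFilling.InRow x i) ↔ ∀ i, i + 1 < n → v (i + 1) < v i := by
  have key := rectFuel_stackOne hf hv le_rfl
  by_cases hd : ∀ i, i + 1 < n → v (i + 1) < v i
  · refine ⟨fun _ => hd, fun _ x _ i => ?_⟩
    rw [key.1 hd, inRow_stackOne]
    constructor
    · rintro ⟨j, hj⟩
      beta_reduce at hj
      split_ifs at hj with h
      exact ⟨h.1, (Option.some.inj hj).symm⟩
    · rintro ⟨h1, h2⟩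
      exact ⟨0, by beta_reduce; rw [if_pos ⟨h1, rfl⟩, h2]⟩
  · refine ⟨fun h => ?_, fun h => absurd h hd⟩
    obtain ⟨t, ht, ha⟩ := key.2 hd
    obtain ⟨j, hj⟩ := (h (v t) (Finset.mem_Icc.mpr ⟨hv.pos t ht, hv.le t ht⟩) (n - 1 - t)).mpr
      (inRow_stackOne.mpr ⟨by omega, by rw [show n - 1 - (n - 1 - t) = t by omega]⟩)
    exact absurd (ha _ _ hj) (lt_irrefl _)

/-! ### The tableaux of a permutation -/

/-- The letters of `w`, numbered from `0`. -/
def letter (w : Equiv.Perm (Fin n)) (i : ℕ) : ℕ := if h : i < n then (w ⟨i, h⟩ : ℕ) + 1 else 0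

theorem letter_of_lt (w : Equiv.Perm (Fin n)) {i : ℕ} (h : i < n) :
    letter w i = (w ⟨i, h⟩ : ℕ) + 1 := dif_pos h

theorem isWord_letter (w : Equiv.Perm (Fin n)) : IsWord (letter w) n n where
  pos := fun i hi => by rw [letter_of_lt w hi]; omega
  le := fun i hi => by rw [letter_of_lt w hi]; omega
  inj := fun i hi j hj h => by
    rw [letter_of_lt w hi, letter_of_lt w hj] at h
    have := w.injective (Fin.ext (Nat.succ_injective h))
    simpa using this

theorem word_eq_prefixWord (w : Equiv.Perm (Fin n)) : word w = prefixWord (letter w) n := by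
  apply List.ext_getElem
  · simp [word, prefixWord]
  · intro i h1 h2
    have hi : i < n := by simpa [word] using h1
    simp [word, prefixWord, letter_of_lt w hi]

theorem stackOne_eq_ofFn (v : ℕ → ℕ) (m : ℕ) :
    stackOne v m = List.ofFn fun i : Fin m => (m - 1 - (i : ℕ), [v (m - 1 - i)]) := by
  induction m with
  | zero => rfl
  | succ m ih =>
    rw [stackOne, ih, List.ofFn_succ]
    simp [Nat.sub_sub, Nat.add_comm 1]

theorem permTableau_eq (w : Equiv.Perm (Fin n)) : permTableau w = stackOne (letter w) n := by
  rw [stackOne_eq_ofFn, permTableau]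
  congr 1
  funext i
  rw [letter_of_lt w (by omega)]
  congr 5
  apply Fin.ext
  simp [Fin.val_rev]
  omega

theorem size_stackOne (v : ℕ → ℕ) (m : ℕ) : (stackOne v m).size = m := by
  induction m with
  | zero => rfl
  | succ m ih =>
    rw [SkewRows.size] at ih ⊢
    simp [stackOne, ih, Nat.add_comm]

theorem size_stackTwo (N : ℕ) (v : ℕ → ℕ) (m : ℕ) : (stackTwo N v m).size = 2 * m := by
  induction m with
  | zero => rfl
  | succ m ih =>
    rw [SkewRows.size] at ih ⊢
    simp [stackTwo, ih]
    omega

theorem copies_two_stackOne (v : ℕ → ℕ) (n : ℕ) : (stackOne v n).copies 2 = stackTwo n v n := by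
  rw [SkewRows.copies, size_stackOne]
  generalize n = N
  suffices h : ∀ m, (stackOne v m).map (fun r => (r.1, (List.range 2).flatMap fun t =>
    r.2.map fun x => x + t * N)) = stackTwo N v m from h N
  intro m
  induction m with
  | zero => rfl
  | succ m ih =>
    rw [stackOne, List.map_cons, ih, stackTwo]
    simp [List.range_succ]

theorem copies_one (S : SkewRows) : S.copies 1 = S := by
  simp [SkewRows.copies]

theorem stabilizesAt_one_iff (hn : 1 ≤ n) (w : Equiv.Perm (Fin n)) :
    StabilizesAt (permTableau w) 1 ↔ ∀ i, i + 1 < n → letter w (i + 1) < letter w i := by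
  rw [← stable_one_iff (isWord_letter w) hn, StabilizesAt, copies_one, permTableau_eq,
    size_stackOne]
  simp [rect, rectFuel, size_stackOne]

theorem stabilizesAt_two_iff (hn : 1 ≤ n) (w : Equiv.Perm (Fin n)) :
    StabilizesAt (permTableau w) 2 ↔ ∃ k, 1 ≤ k ∧ k ≤ n ∧ IsTwoRun (letter w) n k := by
  rw [← stable_two_iff (f := 2 * n) hn (isWord_letter w) (by omega), StabilizesAt, permTableau_eq,
    size_stackOne, copies_two_stackOne]
  simp [rect, rectFuel, size_stackTwo]

theorem permStab_eq_two_iff (w : Equiv.Perm (Fin n)) : permStab w = 2 ↔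
    StabilizesAt (permTableau w) 2 ∧ ¬ StabilizesAt (permTableau w) 1 := by
  rw [permStab, stab]
  constructor
  · intro h
    refine ⟨?_, fun h1 => ?_⟩
    -- `sInf ∅ = 0`, so the value `2` is attained by an actual element.
    · have hne : {k | StabilizesAt (permTableau w) k}.Nonempty := by
        by_contra hne
        rw [Set.not_nonempty_iff_eq_empty.mp hne, Nat.sInf_empty] at h
        omega
      have := Nat.sInf_mem hne
      rwa [h] at this
    · have := Nat.sInf_le (s := {k | StabilizesAt (permTableau w) k}) h1
      omega
  · rintro ⟨h2, h1⟩
    apply le_antisymm (Nat.sInf_le h2)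
    have := Nat.sInf_mem (s := {k | StabilizesAt (permTableau w) k}) ⟨2, h2⟩
    by_contra hlt
    have h3 := this.1
    obtain h4 : sInf {k | StabilizesAt (permTableau w) k} = 1 := by omega
    rw [h4] at this
    exact h1 this

theorem isTwoRun_not_decreasing (hk : 1 ≤ k) (hkn : k < n) (h : IsTwoRun v n k) :
    ¬ ∀ i, i + 1 < n → v (i + 1) < v i := by
  intro hdec
  have hdec : ∀ i j, i < j → j < n → v j < v i := by
    intro i j hij
    induction j, hij using Nat.le_induction with
    | base => exact hdec i
    | succ j hj ih => exact fun h' => (hdec j h').trans (ih (by omega))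
  rcases Nat.lt_or_ge k (n - k) with h4 | h4
  · have := h.long h4.le 0 hk
    have := hdec 0 k hk (by omega)
    simp only [Nat.add_zero] at *
    omega
  · have := h.short h4 0 (by omega)
    have := hdec (k - 1) (n - 1) (by omega) (by omega)
    simp only [Nat.sub_zero] at *
    omega

/-- `IsTwoRun` with `k = n` says that the word is decreasing, which is stabilization at `1`; for `k
< n` there is an ascent. -/
theorem permStab_eq_two_iff_isTwoRun (hn : 1 ≤ n) (w : Equiv.Perm (Fin n)) :
    permStab w = 2 ↔ ∃ k, 1 ≤ k ∧ k < n ∧ IsTwoRun (letter w) n k := by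
  rw [permStab_eq_two_iff, stabilizesAt_one_iff hn, stabilizesAt_two_iff hn]
  constructor
  · rintro ⟨⟨k, h1, h2, h3⟩, h4⟩
    refine ⟨k, h1, lt_of_le_of_ne h2 ?_, h3⟩
    rintro rfl
    exact h4 h3.first
  · rintro ⟨k, h1, h2, h3⟩
    exact ⟨⟨k, h1, h2.le, h3⟩, isTwoRun_not_decreasing h1 h2 h3⟩

theorem recordingTableau_eq_iff (w : Equiv.Perm (Fin n)) (hk : 1 ≤ k) (hkn : k ≤ n) :
    recordingTableau w = twoColumnTableau n k ↔ IsTwoRun (letter w) n k := by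
  rw [recordingTableau, word_eq_prefixWord, recording_eq_iff hk hkn,
    run_iff_rows (isWord_letter w) hk hkn]

end

/-! ### Ballot sets -/

open Finset in
/-- The `t`-element subsets of `{0, …, n - 1}` that contain at most half of each initial segment. -/
def ballotSets (n t : ℕ) : Finset (Finset ℕ) :=
  (powersetCard t (range n)).filter fun S => ∀ j ≤ n, 2 * (S.filter (· < j)).card ≤ j

theorem mem_ballotSets {n t : ℕ} {S : Finset ℕ} : S ∈ ballotSets n t ↔
    (S ⊆ Finset.range n ∧ S.card = t) ∧ ∀ j ≤ n, 2 * (S.filter (· < j)).card ≤ j := by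
  rw [ballotSets, Finset.mem_filter, Finset.mem_powersetCard]

theorem filter_lt_of_subset {n j : ℕ} {S : Finset ℕ} (hS : S ⊆ Finset.range n) (hj : n ≤ j) :
    S.filter (· < j) = S := by
  apply Finset.filter_true_of_mem
  intro x hx
  have := Finset.mem_range.mp (hS hx)
  omega

theorem ballotSets_zero (n : ℕ) : (ballotSets n 0).card = 1 := by
  rw [Finset.card_eq_one]
  refine ⟨∅, ?_⟩
  ext S
  rw [mem_ballotSets, Finset.mem_singleton, Finset.card_eq_zero]
  constructor
  · exact fun h => h.1.2
  · rintro rfl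
    simp

/-- Split according to whether `n` belongs to the set; by `h` the ballot condition for the full
segment holds automatically. -/
theorem ballotSets_succ {n t : ℕ} (h : 2 * (t + 1) ≤ n + 1) :
    ballotSets (n + 1) (t + 1) =
      ballotSets n (t + 1) ∪ (ballotSets n t).image (insert n) := by
  ext S
  rw [Finset.mem_union, Finset.mem_image]
  constructor
  · intro hS
    obtain ⟨⟨h1, h2⟩, h3⟩ := mem_ballotSets.mp hS
    by_cases hn : n ∈ S
    · right
      refine ⟨S.erase n, mem_ballotSets.mpr ⟨⟨?_, ?_⟩, fun j hj => ?_⟩, Finset.insert_erase hn⟩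
      · intro x hx
        have h4 := Finset.mem_range.mp (h1 (Finset.mem_of_mem_erase hx))
        have h5 := Finset.ne_of_mem_erase hx
        rw [Finset.mem_range]
        omega
      · rw [Finset.card_erase_of_mem hn, h2]; rfl
      · refine le_trans ?_ (h3 j (by omega))
        exact Nat.mul_le_mul_left _ (Finset.card_le_card
          (Finset.filter_subset_filter _ (Finset.erase_subset _ _)))
    · left
      refine mem_ballotSets.mpr ⟨⟨?_, h2⟩, fun j hj => h3 j (by omega)⟩
      intro x hx
      have h4 := Finset.mem_range.mp (h1 hx)
      have h5 : x ≠ n := fun e => hn (e ▸ hx)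
      rw [Finset.mem_range]
      omega
  · rintro (hS | ⟨S, hS, rfl⟩)
    · obtain ⟨⟨h1, h2⟩, h3⟩ := mem_ballotSets.mp hS
      refine mem_ballotSets.mpr ⟨⟨h1.trans (Finset.range_mono (Nat.le_succ n)), h2⟩, fun j hj => ?_⟩
      rcases hj.eq_or_lt with rfl | hj
      · rw [filter_lt_of_subset h1 (by omega)]; omega
      · exact h3 j (by omega)
    · obtain ⟨⟨h1, h2⟩, h3⟩ := mem_ballotSets.mp hS
      have hn : n ∉ S := fun h' => by simpa using h1 h'
      have hsub : insert n S ⊆ Finset.range (n + 1) := by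
        rw [Finset.range_add_one]
        exact Finset.insert_subset_insert _ h1
      have hcard : (insert n S).card = t + 1 := by rw [Finset.card_insert_of_notMem hn, h2]
      refine mem_ballotSets.mpr ⟨⟨hsub, hcard⟩, fun j hj => ?_⟩
      rcases hj.eq_or_lt with rfl | hj
      · rw [filter_lt_of_subset hsub le_rfl]; omega
      · rw [Finset.filter_insert, if_neg (by omega)]
        exact h3 j (by omega)

theorem card_ballotSets_succ {n t : ℕ} (h : 2 * (t + 1) ≤ n + 1) :
    (ballotSets (n + 1) (t + 1)).card = (ballotSets n (t + 1)).card + (ballotSets n t).card := by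
  have hn : ∀ {s} {S : Finset ℕ}, S ∈ ballotSets n s → n ∉ S := fun hS h' => by
    simpa using (mem_ballotSets.mp hS).1.1 h'
  rw [ballotSets_succ h, Finset.card_union_of_disjoint, Finset.card_image_of_injOn]
  · intro S hS S' hS' e
    rw [← Finset.erase_insert (hn hS), ← Finset.erase_insert (hn hS')]
    exact congrArg (fun s => Finset.erase s n) e
  · rw [Finset.disjoint_left]
    intro S hS hS'
    obtain ⟨S', -, rfl⟩ := Finset.mem_image.mp hS'
    exact hn hS (Finset.mem_insert_self _ _)

/-- Pascal's recursion. The range of `t` includes the boundary `2 * (t + 1) = n + 1`, where there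
are no ballot sets and two neighbouring binomials agree, so that the induction closes. -/
theorem card_ballotSets {n t : ℕ} (h : 2 * (t + 1) ≤ n + 1) :
    (ballotSets n (t + 1)).card + n.choose t = n.choose (t + 1) := by
  induction n generalizing t with
  | zero => omega
  | succ n ih =>
    rcases Nat.lt_or_ge (n + 1) (2 * (t + 1)) with h' | h'
    · have h0 : ballotSets (n + 1) (t + 1) = ∅ := by
        rw [Finset.eq_empty_iff_forall_notMem]
        intro S hS
        obtain ⟨⟨h1, h2⟩, h3⟩ := mem_ballotSets.mp hS
        have := h3 (n + 1) le_rfl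
        rw [filter_lt_of_subset h1 le_rfl] at this
        omega
      obtain rfl : n = 2 * t := by omega
      rw [h0, Nat.choose_symm_half]
      simp
    · rw [card_ballotSets_succ h', Nat.choose_succ_succ' n t]
      have h1 := ih h'
      cases t with
      | zero => rw [ballotSets_zero]; simp at h1 ⊢; omega
      | succ t =>
        have h2 := ih (t := t) (by omega)
        rw [Nat.choose_succ_succ' n t]
        omega

/-! ### Permutations with two decreasing runs -/

section

variable {n k : ℕ}

/-- The letters of `w`, numbered from `0`, in the reverse order of the alphabet `0, …, n - 1`. -/
def coletter (w : Equiv.Perm (Fin n)) (i : ℕ) : ℕ := n - letter w i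

theorem coletter_of_lt (w : Equiv.Perm (Fin n)) {i : ℕ} (h : i < n) :
    coletter w i = (w ⟨i, h⟩).rev := by
  rw [coletter, letter_of_lt w h, Fin.val_rev]

theorem letter_add_coletter (w : Equiv.Perm (Fin n)) {i : ℕ} (h : i < n) :
    letter w i + coletter w i = n := by
  have := (isWord_letter w).le i h
  rw [coletter]
  omega

theorem coletter_lt (w : Equiv.Perm (Fin n)) {i : ℕ} (h : i < n) : coletter w i < n := by
  rw [coletter_of_lt w h]; exact Fin.is_lt _

theorem coletter_inj (w : Equiv.Perm (Fin n)) {i j : ℕ} (hi : i < n) (hj : j < n)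
    (h : coletter w i = coletter w j) : i = j := by
  have h1 := letter_add_coletter w hi
  have h2 := letter_add_coletter w hj
  exact (isWord_letter w).inj i hi j hj (by omega)

theorem perm_ext_coletter {w w' : Equiv.Perm (Fin n)}
    (h : ∀ i < n, coletter w i = coletter w' i) : w = w' := by
  ext i
  have := h i i.isLt
  rw [coletter_of_lt w i.isLt, coletter_of_lt w' i.isLt] at this
  rw [Fin.rev_injective (Fin.ext this)]

/-- The values at the first `k` places. -/
def valueSet (w : Equiv.Perm (Fin n)) (k : ℕ) : Finset ℕ := (Finset.range k).image (coletter w)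

theorem card_valueSet (w : Equiv.Perm (Fin n)) (hk : k ≤ n) : (valueSet w k).card = k := by
  rw [valueSet, Finset.card_image_of_injOn, Finset.card_range]
  intro i hi j hj
  simp only [Finset.coe_range, Set.mem_Iio] at hi hj
  exact coletter_inj w (by omega) (by omega)

theorem valueSet_subset (w : Equiv.Perm (Fin n)) (hk : k ≤ n) :
    valueSet w k ⊆ Finset.range n := by
  intro x hx
  obtain ⟨i, hi, rfl⟩ := Finset.mem_image.mp hx
  rw [Finset.mem_range] at hi ⊢
  exact coletter_lt w (by omega)

theorem valueSet_self (w : Equiv.Perm (Fin n)) : valueSet w n = Finset.range n :=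
  Finset.eq_of_subset_of_card_le (valueSet_subset w le_rfl) (by
    rw [card_valueSet w le_rfl, Finset.card_range])

theorem card_filter_coletter (w : Equiv.Perm (Fin n)) (hk : k ≤ n) (j : ℕ) :
    ((valueSet w k).filter (· < j)).card =
      ((Finset.range k).filter fun i => coletter w i < j).card := by
  rw [valueSet, Finset.filter_image, Finset.card_image_of_injOn]
  intro i hi j hj
  simp only [Finset.coe_filter, Finset.mem_range, Set.mem_ofPred_eq] at hi hj
  exact coletter_inj w (by omega) (by omega)

theorem card_add_card (w : Equiv.Perm (Fin n)) (hk : k ≤ n) {j : ℕ} (hj : j ≤ n) :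
    ((Finset.range k).filter fun i => coletter w i < j).card +
      ((Finset.range (n - k)).filter fun i => coletter w (k + i) < j).card = j := by
  have h1 : ((Finset.range n).filter fun i => coletter w i < j).card = j := by
    rw [← card_filter_coletter w le_rfl, valueSet_self]
    have : (Finset.range n).filter (· < j) = Finset.range j := by
      ext x
      simp only [Finset.mem_filter, Finset.mem_range]
      omega
    rw [this, Finset.card_range]
  have h2 : (Finset.range n).filter (fun i => coletter w i < j) =
      (Finset.range k).filter (fun i => coletter w i < j) ∪
        ((Finset.range (n - k)).filter fun i => coletter w (k + i) < j).image (k + ·) := by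
    ext x
    simp only [Finset.mem_filter, Finset.mem_range, Finset.mem_union, Finset.mem_image]
    constructor
    · rintro ⟨h3, h4⟩
      rcases Nat.lt_or_ge x k with h5 | h5
      · exact Or.inl ⟨h5, h4⟩
      · exact Or.inr ⟨x - k, ⟨by omega, by rwa [Nat.add_sub_cancel' h5]⟩, by omega⟩
    · rintro (⟨h3, h4⟩ | ⟨y, ⟨h3, h4⟩, rfl⟩)
      · exact ⟨by omega, h4⟩
      · exact ⟨by omega, h4⟩
  have h3 := congrArg Finset.card h2
  rw [Finset.card_union_of_disjoint, Finset.card_image_of_injective, h1] at h3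
  · exact h3.symm
  · exact fun a b => Nat.add_left_cancel
  · rw [Finset.disjoint_left]
    intro x hx hx'
    simp only [Finset.mem_filter, Finset.mem_range, Finset.mem_image] at hx hx'
    obtain ⟨y, -, rfl⟩ := hx'
    omega

/-- Both runs of `coletter w`, the first of length `k`, are increasing. -/
def IsIncreasingRuns (w : Equiv.Perm (Fin n)) (k : ℕ) : Prop :=
  (∀ i j, i < j → j < k → coletter w i < coletter w j) ∧
    ∀ i j, i < j → k + j < n → coletter w (k + i) < coletter w (k + j)

theorem lt_of_succ_lt {u : ℕ → ℕ} {a b : ℕ} (h : ∀ i, a ≤ i → i + 1 < b → u i < u (i + 1)) :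
    ∀ i j, a ≤ i → i < j → j < b → u i < u j := by
  intro i j hi hij
  induction j, hij using Nat.le_induction with
  | base => exact h i hi
  | succ j hj ih => exact fun h' => (ih (by omega)).trans (h j (by omega) h')

/-- In the reversed alphabet both runs increase, and `long` says that the `i`-th value of the second
run precedes the `i`-th value of the first. Equivalently, no initial segment has more values from
the first run than from the second. -/
theorem isTwoRun_iff (w : Equiv.Perm (Fin n)) (hkn : 2 * k ≤ n) :
    IsTwoRun (letter w) n k ↔ IsIncreasingRuns w k ∧ valueSet w k ∈ ballotSets n k := by
  have hsum : ∀ i < n, letter w i + coletter w i = n := fun i => letter_add_coletter w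
  have hle := (isWord_letter w).le
  constructor
  · intro h
    have h1 : ∀ i j, i < j → j < k → coletter w i < coletter w j := fun i j hij hj =>
      lt_of_succ_lt (u := coletter w) (a := 0) (b := k) (fun i _ hi => by
        have := h.first i hi
        have := hsum i (by omega)
        have := hsum (i + 1) (by omega)
        omega) i j (Nat.zero_le i) hij hj
    have h2 : ∀ i j, k ≤ i → i < j → j < n → coletter w i < coletter w j :=
      lt_of_succ_lt (fun i hi hi' => by
        have := h.second i hi hi'
        have := hsum i (by omega)
        have := hsum (i + 1) (by omega)
        omega)
    refine ⟨⟨h1, fun i j hij hj => h2 _ _ (by omega) (by omega) hj⟩,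
      mem_ballotSets.mpr ⟨⟨valueSet_subset w (by omega), card_valueSet w (by omega)⟩,
        fun j hj => ?_⟩⟩
    rw [card_filter_coletter w (by omega)]
    have h3 := card_add_card w (k := k) (by omega) hj
    have h4 : ((Finset.range k).filter fun i => coletter w i < j).card ≤
        ((Finset.range (n - k)).filter fun i => coletter w (k + i) < j).card := by
      apply Finset.card_le_card
      intro i hi
      simp only [Finset.mem_filter, Finset.mem_range] at hi ⊢
      have := h.long (by omega) i hi.1
      have := hsum i (by omega)
      have := hsum (k + i) (by omega)
      omega
    omega
  · rintro ⟨⟨h1, h2⟩, h3⟩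
    have hlong : ∀ i < k, letter w i < letter w (k + i) := by
      intro i hi
      by_contra hlt
      have h5 := hsum i (by omega)
      have h6 := hsum (k + i) (by omega)
      have h7 : coletter w i ≠ coletter w (k + i) := fun e => by
        have := coletter_inj w (by omega) (by omega) e
        omega
      -- The segment up to `coletter w i` contains at least `i + 1` values of the first run and, if
      -- the inequality fails at `i`, at most `i` of the second.
      have hj : coletter w i + 1 ≤ n := coletter_lt w (by omega)
      have h8 := (mem_ballotSets.mp h3).2 _ hj
      rw [card_filter_coletter w (by omega)] at h8
      have h9 := card_add_card w (k := k) (by omega) hj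
      have h10 : i + 1 ≤ ((Finset.range k).filter fun x => coletter w x < coletter w i + 1).card := by
        rw [← Finset.card_range (i + 1)]
        apply Finset.card_le_card
        intro x hx
        simp only [Finset.mem_filter, Finset.mem_range] at hx ⊢
        refine ⟨by omega, ?_⟩
        rcases Nat.lt_or_ge x i with hxi | hxi
        · have := h1 x i hxi hi
          omega
        · obtain rfl : x = i := by omega
          omega
      have h11 : ((Finset.range (n - k)).filter
          fun x => coletter w (k + x) < coletter w i + 1).card ≤ i := by
        rw [← Finset.card_range i]
        apply Finset.card_le_card
        intro x hx
        simp only [Finset.mem_filter, Finset.mem_range, Finset.card_range] at hx ⊢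
        by_contra hxi
        rcases Nat.lt_or_ge i x with hix | hix
        · have := h2 i x hix (by omega)
          omega
        · obtain rfl : x = i := by omega
          omega
      omega
    refine ⟨fun i hi => ?_, fun i hi hi' => ?_, fun h i hi => ?_, fun _ => hlong⟩
    · have := h1 i (i + 1) (by omega) hi
      have := hsum i (by omega)
      have := hsum (i + 1) (by omega)
      omega
    · obtain ⟨t, rfl⟩ := Nat.exists_eq_add_of_le hi
      have := h2 t (t + 1) (by omega) (by omega)
      have := hsum (k + t) (by omega)
      have := hsum (k + (t + 1)) (by omega)
      rw [Nat.add_assoc]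
      omega
    · obtain rfl : n = k + k := by omega
      have := hlong (k - 1 - i) (by omega)
      rwa [show k + (k - 1 - i) = k + k - 1 - i by omega] at this

/-- Each run must be the increasing enumeration of its set of values, and the second set is the
complement of the first. -/
theorem IsIncreasingRuns.ext {w w' : Equiv.Perm (Fin n)} (hk : k ≤ n) (h : IsIncreasingRuns w k)
    (h' : IsIncreasingRuns w' k) (e : valueSet w k = valueSet w' k) : w = w' := by
  have hS : ∀ (w : Equiv.Perm (Fin n)), ∀ i < k, coletter w i ∈ valueSet w k := fun w i hi =>
    Finset.mem_image_of_mem _ (Finset.mem_range.mpr hi)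
  have hT : ∀ (w : Equiv.Perm (Fin n)), ∀ i < n - k,
      coletter w (k + i) ∈ Finset.range n \ valueSet w k := fun w i hi => by
    rw [Finset.mem_sdiff, Finset.mem_range]
    refine ⟨coletter_lt w (by omega), fun hm => ?_⟩
    obtain ⟨j, hj, e⟩ := Finset.mem_image.mp hm
    rw [Finset.mem_range] at hj
    have := coletter_inj w (by omega) (by omega) e
    omega
  have hcard : (Finset.range n \ valueSet w' k).card = n - k := by
    rw [Finset.card_sdiff_of_subset (valueSet_subset w' hk), Finset.card_range,
      card_valueSet w' hk]
  have key1 : ∀ {w₁ : Equiv.Perm (Fin n)}, IsIncreasingRuns w₁ k →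
      valueSet w₁ k = valueSet w' k →
      (fun i : Fin k => coletter w₁ i) = (valueSet w' k).orderEmbOfFin (card_valueSet w' hk) := by
    intro w₁ h₁ e₁
    apply Finset.orderEmbOfFin_unique
    · intro i
      rw [← e₁]
      exact hS w₁ i i.isLt
    · intro i j hij
      exact h₁.1 i j hij j.isLt
  have key2 : ∀ {w₁ : Equiv.Perm (Fin n)}, IsIncreasingRuns w₁ k →
      valueSet w₁ k = valueSet w' k → (fun i : Fin (n - k) => coletter w₁ (k + i)) =
        (Finset.range n \ valueSet w' k).orderEmbOfFin hcard := by
    intro w₁ h₁ e₁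
    apply Finset.orderEmbOfFin_unique
    · intro i
      rw [← e₁]
      exact hT w₁ i i.isLt
    · intro i j hij
      exact h₁.2 i j hij (by omega)
  apply perm_ext_coletter
  intro i hi
  rcases Nat.lt_or_ge i k with h3 | h3
  · exact congrFun ((key1 h e).trans (key1 h' rfl).symm) ⟨i, h3⟩
  · obtain ⟨t, rfl⟩ := Nat.exists_eq_add_of_le h3
    exact congrFun ((key2 h e).trans (key2 h' rfl).symm) ⟨t, by omega⟩

theorem exists_isIncreasingRuns (hk : k ≤ n) {S : Finset ℕ} (hS : S ⊆ Finset.range n)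
    (hcard : S.card = k) : ∃ w : Equiv.Perm (Fin n), IsIncreasingRuns w k ∧ valueSet w k = S := by
  have hcard' : (Finset.range n \ S).card = n - k := by
    rw [Finset.card_sdiff_of_subset hS, Finset.card_range, hcard]
  set a := S.orderEmbOfFin hcard
  set b := (Finset.range n \ S).orderEmbOfFin hcard'
  have ha : ∀ i, a i ∈ S := fun i => Finset.orderEmbOfFin_mem _ _ _
  have hb : ∀ i, b i ∈ Finset.range n \ S := fun i => Finset.orderEmbOfFin_mem _ _ _
  have ha' : ∀ i, a i < n := fun i => Finset.mem_range.mp (hS (ha i))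
  have hb' : ∀ i, b i < n := fun i => Finset.mem_range.mp (Finset.mem_sdiff.mp (hb i)).1
  let u : Fin n → Fin n := fun i =>
    if h : (i : ℕ) < k then ⟨a ⟨i, h⟩, ha' _⟩ else ⟨b ⟨i - k, by omega⟩, hb' _⟩
  have hu1 : ∀ (i : ℕ) (hi : i < k), (u ⟨i, by omega⟩ : ℕ) = a ⟨i, hi⟩ := fun i hi => by
    simp only [u, dif_pos hi]
  have hu2 : ∀ (i : ℕ) (hi : i < n - k), (u ⟨k + i, by omega⟩ : ℕ) = b ⟨i, hi⟩ := fun i hi => by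
    simp only [u]
    rw [dif_neg (by omega)]
    apply congrArg (fun x => (b x : ℕ))
    exact Fin.ext (by simp)
  have hinj : Function.Injective u := by
    intro i j hij
    have hij' : (u i : ℕ) = u j := congrArg _ hij
    have hne : ∀ x y, a x ≠ b y := fun x y e => (Finset.mem_sdiff.mp (hb y)).2 (e ▸ ha x)
    apply Fin.ext
    by_cases h1 : (i : ℕ) < k <;> by_cases h2 : (j : ℕ) < k <;>
      simp only [u, h1, h2, dif_pos, dif_neg, not_false_eq_true] at hij'
    · simpa using a.injective hij'
    · exact absurd hij' (hne _ _)
    · exact absurd hij'.symm (hne _ _)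
    · have := b.injective hij'
      simp only [Fin.mk.injEq] at this
      omega
  -- `u` prescribes the values in the reversed alphabet, so `w` is `u` followed by the reversal.
  let w : Equiv.Perm (Fin n) :=
    (Equiv.ofBijective u (Finite.injective_iff_bijective.mp hinj)).trans Fin.revPerm
  have hw : ∀ (i : ℕ) (hi : i < n), coletter w i = u ⟨i, hi⟩ := fun i hi => by
    rw [coletter_of_lt w hi]
    simp [w]
  have hval : valueSet w k ⊆ S := by
    intro x hx
    obtain ⟨i, hi, rfl⟩ := Finset.mem_image.mp hx
    rw [Finset.mem_range] at hi
    rw [hw i (by omega), hu1 i hi]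
    exact ha _
  refine ⟨w, ⟨fun i j hij hj => ?_, fun i j hij hj => ?_⟩,
    Finset.eq_of_subset_of_card_le hval (by rw [card_valueSet w hk, hcard])⟩
  · rw [hw i (by omega), hw j (by omega), hu1 i (by omega), hu1 j hj]
    exact a.strictMono hij
  · rw [hw _ (by omega), hw _ hj, hu2 i (by omega), hu2 j (by omega)]
    exact b.strictMono hij

theorem ncard_isTwoRun_of_le (hkn : 2 * k ≤ n) :
    {w : Equiv.Perm (Fin n) | IsTwoRun (letter w) n k}.ncard = (ballotSets n k).card := by
  rw [← Set.ncard_coe_finset]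
  apply Set.ncard_congr fun w _ => valueSet w k
  · intro w hw
    exact ((isTwoRun_iff w hkn).mp hw).2
  · intro w w' hw hw' e
    exact ((isTwoRun_iff w hkn).mp hw).1.ext (by omega) ((isTwoRun_iff w' hkn).mp hw').1 e
  · intro S hS
    have hS' := mem_ballotSets.mp hS
    obtain ⟨w, hw, e⟩ := exists_isIncreasingRuns (by omega) hS'.1.1 hS'.1.2
    exact ⟨w, (isTwoRun_iff w hkn).mpr ⟨hw, e ▸ hS⟩, e⟩

/-! ### Reverse complements -/

/-- The two runs change places, and with them `first` and `second`, `short` and `long`. -/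
theorem IsTwoRun.reverseComplement {v v' : ℕ → ℕ} (h : IsTwoRun v n k) (hk : k ≤ n)
    (hv : ∀ i < n, v' i + v (n - 1 - i) = n + 1) : IsTwoRun v' n (n - k) where
  first := fun i hi => by
    have h1 := h.second (n - 1 - (i + 1)) (by omega) (by omega)
    rw [show n - 1 - (i + 1) + 1 = n - 1 - i by omega] at h1
    have := hv i (by omega)
    have := hv (i + 1) (by omega)
    omega
  second := fun i hi hi' => by
    have h1 := h.first (n - 1 - (i + 1)) (by omega)
    rw [show n - 1 - (i + 1) + 1 = n - 1 - i by omega] at h1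
    have := hv i (by omega)
    have := hv (i + 1) (by omega)
    omega
  short := fun h' i hi => by
    have h1 := h.long (by omega) i (by omega)
    have h2 := hv (n - k - 1 - i) (by omega)
    have h3 := hv (n - 1 - i) (by omega)
    rw [show n - 1 - (n - k - 1 - i) = k + i by omega] at h2
    rw [show n - 1 - (n - 1 - i) = i by omega] at h3
    omega
  long := fun h' i hi => by
    have h1 := h.short (by omega) i (by omega)
    have h2 := hv i (by omega)
    have h3 := hv (n - k + i) (by omega)
    rw [show n - 1 - (n - k + i) = k - 1 - i by omega] at h3
    omega

/-- The reverse complement of `w`. -/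
def reverseComplement (w : Equiv.Perm (Fin n)) : Equiv.Perm (Fin n) :=
  Fin.revPerm.trans (w.trans Fin.revPerm)

theorem reverseComplement_reverseComplement (w : Equiv.Perm (Fin n)) :
    reverseComplement (reverseComplement w) = w := by
  ext i
  simp [reverseComplement]

theorem letter_reverseComplement (w : Equiv.Perm (Fin n)) {i : ℕ} (hi : i < n) :
    letter (reverseComplement w) i + letter w (n - 1 - i) = n + 1 := by
  rw [letter_of_lt _ hi, letter_of_lt w (by omega : n - 1 - i < n)]
  have e : (⟨i, hi⟩ : Fin n).rev = ⟨n - 1 - i, by omega⟩ := by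
    apply Fin.ext
    rw [Fin.val_rev]
    simp only
    omega
  simp only [reverseComplement, Equiv.trans_apply, Fin.revPerm_apply, e, Fin.val_rev]
  have := (w ⟨n - 1 - i, by omega⟩).isLt
  omega

theorem ncard_isTwoRun_sub (hk : k ≤ n) :
    {w : Equiv.Perm (Fin n) | IsTwoRun (letter w) n (n - k)}.ncard =
      {w : Equiv.Perm (Fin n) | IsTwoRun (letter w) n k}.ncard := by
  apply Set.ncard_congr fun w _ => reverseComplement w
  · intro w hw
    have := IsTwoRun.reverseComplement hw (by omega) fun i hi => letter_reverseComplement w hi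
    rwa [Nat.sub_sub_self hk] at this
  · intro w w' _ _ e
    rw [← reverseComplement_reverseComplement w, e, reverseComplement_reverseComplement]
  · intro w hw
    exact ⟨reverseComplement w, IsTwoRun.reverseComplement hw hk
      fun i hi => letter_reverseComplement w hi, reverseComplement_reverseComplement w⟩

/-! ### Summation over the length of the first run -/

theorem ncard_isTwoRun (hk : 1 ≤ k) (hkn : 2 * k ≤ n) :
    ({w : Equiv.Perm (Fin n) | IsTwoRun (letter w) n k}.ncard : ℤ) =
      n.choose k - n.choose (k - 1) := by
  obtain ⟨t, rfl⟩ : ∃ t, k = t + 1 := ⟨k - 1, by omega⟩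
  have := card_ballotSets (n := n) (t := t) (by omega)
  rw [ncard_isTwoRun_of_le hkn, Nat.add_sub_cancel]
  omega

/-- The word determines the rows of its recording tableau, and the row sequences for different `k`
differ. -/
theorem isTwoRun_unique {k' : ℕ} (w : Equiv.Perm (Fin n)) (hk : 1 ≤ k) (hkn : k ≤ n)
    (hk' : 1 ≤ k') (hkn' : k' ≤ n) (h : IsTwoRun (letter w) n k)
    (h' : IsTwoRun (letter w) n k') : k = k' := by
  have e := (run_iff_rows (isWord_letter w) hk hkn).mp h
  have e' := (run_iff_rows (isWord_letter w) hk' hkn').mp h'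
  have e1 := e k
  have e2 := e k'
  have e3 := e' k
  have e4 := e' k'
  simp only [twoColumnRow] at e1 e2 e3 e4
  grind

theorem sum_Ico_choose_sub (n h : ℕ) :
    ∑ k ∈ Finset.Ico 1 (h + 1), ((n.choose k : ℤ) - n.choose (k - 1)) = n.choose h - 1 := by
  induction h with
  | zero => simp
  | succ h ih =>
    rw [Finset.sum_Ico_succ_top (by omega), ih, Nat.add_sub_cancel]
    ring

theorem choose_half_add (hn : 1 ≤ n) :
    n.choose (n / 2) + n.choose (n - n / 2 - 1) = (n + 1).choose ((n + 1) / 2) := by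
  rcases Nat.even_or_odd' n with ⟨m, rfl | rfl⟩
  · obtain ⟨t, rfl⟩ : ∃ t, m = t + 1 := ⟨m - 1, by omega⟩
    rw [show 2 * (t + 1) / 2 = t + 1 by omega, show 2 * (t + 1) - (t + 1) - 1 = t by omega,
      show (2 * (t + 1) + 1) / 2 = t + 1 by omega, Nat.choose_succ_succ (2 * (t + 1)) t, Nat.add_comm]
  · rw [show (2 * m + 1) / 2 = m by omega, show 2 * m + 1 - m - 1 = m by omega,
      show (2 * m + 1 + 1) / 2 = m + 1 by omega, Nat.choose_succ_succ (2 * m + 1) m,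
      Nat.choose_symm_half]

theorem ncard_exists_isTwoRun (hn : 1 ≤ n) :
    ({w : Equiv.Perm (Fin n) | ∃ k, 1 ≤ k ∧ k < n ∧ IsTwoRun (letter w) n k}.ncard : ℤ) =
      (n + 1).choose ((n + 1) / 2) - 2 := by
  classical
  have e : {w : Equiv.Perm (Fin n) | ∃ k, 1 ≤ k ∧ k < n ∧ IsTwoRun (letter w) n k} =
      ((Finset.Ico 1 n).biUnion fun k =>
        Finset.univ.filter fun w : Equiv.Perm (Fin n) => IsTwoRun (letter w) n k : Finset _) := by
    ext w
    simp [and_assoc]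
  have hcard : ∀ k, (Finset.univ.filter fun w : Equiv.Perm (Fin n) =>
      IsTwoRun (letter w) n k).card =
        {w : Equiv.Perm (Fin n) | IsTwoRun (letter w) n k}.ncard := fun k => by
    rw [← Set.ncard_coe_finset]
    simp
  rw [e, Set.ncard_coe_finset, Finset.card_biUnion]
  · simp only [hcard]
    push_cast
    -- Up to `n / 2` the ballot count applies directly; beyond it, `k` is replaced by `n - k`.
    rw [← Finset.sum_Ico_consecutive _ (m := 1) (n := n / 2 + 1) (k := n) (by omega) (by omega)]
    have h1 : ∑ k ∈ Finset.Ico 1 (n / 2 + 1),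
        ({w : Equiv.Perm (Fin n) | IsTwoRun (letter w) n k}.ncard : ℤ) =
          n.choose (n / 2) - 1 := by
      rw [← sum_Ico_choose_sub]
      apply Finset.sum_congr rfl
      intro k hk
      rw [Finset.mem_Ico] at hk
      exact ncard_isTwoRun hk.1 (by omega)
    have h2 : ∑ k ∈ Finset.Ico (n / 2 + 1) n,
        ({w : Equiv.Perm (Fin n) | IsTwoRun (letter w) n k}.ncard : ℤ) =
          n.choose (n - n / 2 - 1) - 1 := by
      have h3 : ∑ k ∈ Finset.Ico (n / 2 + 1) n,
          ({w : Equiv.Perm (Fin n) | IsTwoRun (letter w) n k}.ncard : ℤ) =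
          ∑ k ∈ Finset.Ico (n / 2 + 1) n,
            ({w : Equiv.Perm (Fin n) | IsTwoRun (letter w) n (n - k)}.ncard : ℤ) := by
        apply Finset.sum_congr rfl
        intro k hk
        rw [Finset.mem_Ico] at hk
        rw [ncard_isTwoRun_sub (by omega)]
      rw [h3, Finset.sum_Ico_reflect (fun k =>
        ({w : Equiv.Perm (Fin n) | IsTwoRun (letter w) n k}.ncard : ℤ)) _ (by omega),
        show n + 1 - n = 1 by omega, show n + 1 - (n / 2 + 1) = n - n / 2 - 1 + 1 by omega,
        ← sum_Ico_choose_sub]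
      apply Finset.sum_congr rfl
      intro k hk
      rw [Finset.mem_Ico] at hk
      exact ncard_isTwoRun hk.1 (by omega)
    rw [h1, h2, ← choose_half_add hn]
    push_cast
    ring
  · intro k hk k' hk' hne
    rw [Function.onFun, Finset.disjoint_left]
    intro w hw hw'
    simp only [Finset.coe_Ico, Set.mem_Ico] at hk hk'
    exact hne (isTwoRun_unique w hk.1 hk.2.le hk'.1 hk'.2.le (Finset.mem_filter.mp hw).2
      (Finset.mem_filter.mp hw').2)

end

end TableauStab

theorem mainTheorem9 (n : ℕ) (hn : 1 ≤ n) :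
    {w : Equiv.Perm (Fin n) | TableauStab.permStab w = 2} =
        {w : Equiv.Perm (Fin n) | ∃ k : ℕ, 1 ≤ k ∧ k < n ∧
          TableauStab.recordingTableau w = TableauStab.twoColumnTableau n k} ∧
      (({w : Equiv.Perm (Fin n) | TableauStab.permStab w = 2}.ncard : ℕ) : ℤ) =
        ((n + 1).choose ((n + 1) / 2) : ℤ) - 2 := by
  constructor
  · ext w
    rw [Set.mem_ofPred_eq, TableauStab.permStab_eq_two_iff_isTwoRun hn, Set.mem_ofPred_eq]
    refine exists_congr fun k => and_congr_right fun hk => and_congr_right fun hkn => ?_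
    rw [TableauStab.recordingTableau_eq_iff w hk hkn.le]
  · simp only [TableauStab.permStab_eq_two_iff_isTwoRun hn]
    exact TableauStab.ncard_exists_isTwoRun hn
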